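/- **Setting.** Fix $D>0$, $\Delta>0$, mean angles $\theta_1$ (Bob), $\theta_2$ (Ava) with $[\theta_k-\Delta,\theta_k+\Delta]\subseteq[-\pi/3,\pi/3]$, integers $1\le L\le s\le N$, and $s$ distinct subcarriers $p_1,\dots,p_s\in\{0,\dots,N-1\}$. For $N_T$ antennas let $$[\mathbf R_k]_{m,n}=\frac1{2\Delta L}\int_{\theta_k-\Delta}^{\theta_k+\Delta}e^{-j2\pi D(m-n)\sin\theta}\,d\theta ,\qquad k=1,2,\quad 1\le m,n\le N_T .$$ Let $\mathbf F$ be the $s\times L$ matrix with entries $e^{-2\pi j p_k l/N}$ ($0\le l<L$), $\mathbf R_F=\mathbf F^*\mathbf F^T$, and $\overline{\mathbf R}_F$ its Moore–Penrose inverse. Write $\mathbf R_1=\mathbf U\,\mathrm{diag}(\lambda_i)\,\mathbf U^H$. Fix $c>0$ and thresholds $\tau_{N_T}\ge c$. Let $\rho_1$ be the number of (significant) eigenvalues $\lambda_i\ge\tau_{N_T}$, and $\overline{\mathbf R}_1=\mathbf U\,\mathrm{diag}(\overline\lambda_i)\,\mathbf U^H$ with $\overline\lambda_i=1/\lambda_i$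 for these eigenvalues and $\overline\lambda_i=0$ for the others. For a row vector $\mathbf r\in\mathbb C^{N_Ts}$ put $f(\mathbf r)=\mathbf r(\overline{\mathbf R}_1\otimes\overline{\mathbf R}_F)\mathbf r^H$. The channels are $$\mathbf h_B=\mathbf g_B(\mathbf R_1^{1/2}\otimes\mathbf F^T),\qquad \mathbf h_A=\mathbf g_A(\mathbf R_2^{1/2}\otimes\mathbf F^T),$$ where $\mathbf g_B,\mathbf g_A\in\mathbb C^{1\times N_TL}$ have i.i.d. $\mathcal{CN}(0,1)$ entries. For estimates $\hat{\mathbf h}_B,\hat{\mathbf h}_A$ let $\Delta f=f(\hat{\mathbf h}_B)-f(\hat{\mathbf h}_A)$. No assumption is made on the joint law for different values of $N_T$. **Theorem 3.** As $N_T\to\infty$, $\Delta f$ is asymptotically equivalent to $L\{\rho_1-\mathrm{Tr}(\mathbf R_2\overline{\mathbf R}_1)\}$ on the scale $N_Ts$, that is, almost surely $$\frac{\Delta f-L\{\rho_1-\mathrm{Tr}(\mathbf R_2\overline{\mathbf R}_1)\}}{N_Ts}\longrightarrow 0 ,$$ in each of the following two situations. 1. *(Estimates from the received signal, high SNR.)*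 Let $\mathbf X=[\mathbf x_1\ \mathbf x_2]$ be an invertible $2\times2$ pilot matrix with $\mathbf x_1=\sqrt{\rho_B}\,(e^{j\phi_0},e^{j\phi_1})^T$, $\mathbf x_2=\sqrt{\rho_A}\,(e^{j\psi_0},e^{j\psi_1})^T$, $\rho_B,\rho_A>0$. Let $\mathbf Y=\mathbf X\begin{bmatrix}\mathbf h_B\\ \mathbf h_A\end{bmatrix}+\sigma\mathbf Z$, where for each $N_T$ all the entries of $\mathbf g_B,\mathbf g_A,\mathbf Z$ are i.i.d. $\mathcal{CN}(0,1)$. Put $\mathbf C=\frac1{N_Ts}\mathbf Y\mathbf Y^H$, $T_k=\frac{\mathrm{Tr}(\mathbf R_k)\mathrm{Tr}(\mathbf R_F)}{N_Ts}$, $\hat{\mathbf h}_B=T_1\mathbf x_1^H\mathbf C^{-1}\mathbf Y$ and $\hat{\mathbf h}_A=T_2\mathbf x_2^H\mathbf C^{-1}\mathbf Y$. Then, almost surely, the convergence holds as $N_T\to\infty$ and $\sigma\to0$, $\sigma\ge0$, jointly. 2. *(Gaussian estimation errors of equal mean square.)* Let $\hat{\mathbf h}_B=\mathbf h_B-\varepsilon\mathbf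 h$ and $\hat{\mathbf h}_A=\mathbf h_A-\varepsilon\mathbf h'$, where $\mathbf h,\mathbf h'$ have i.i.d. $\mathcal{CN}(0,1)$ entries, $\mathbf h$ is independent of $\mathbf g_B$, $\mathbf h'$ is independent of $\mathbf g_A$, and the real numbers $\varepsilon=\varepsilon_{N_T}$ are bounded. Then, almost surely, the convergence holds as $N_T\to\infty$. -/

import Mathlib

open MeasureTheory ProbabilityTheory Filter Topology
open scoped Matrix Kronecker

noncomputable section

namespace PilotID

/-- The circularly symmetric complex Gaussian law `CN(0,1)`: real and imaginary parts are
independent, centred, of variance `1/2`. -/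
def cn01 : Measure ℂ :=
  ((gaussianReal 0 (1 / 2)).prod (gaussianReal 0 (1 / 2))).map (fun p => (⟨p.1, p.2⟩ : ℂ))

/-- The family `X` consists of i.i.d. `CN(0,1)` random variables. -/
def IsIIDCN {Ω ι : Type*} [MeasurableSpace Ω] (X : ι → Ω → ℂ) (μ : Measure Ω) : Prop :=
  (∀ i, HasLaw (X i) cn01 μ) ∧ iIndepFun X μ

/-- The one-ring covariance matrix of `n` antennas of spacing `D` wavelengths, mean angle of
arrival `θ`, angular spread `Δ`, for each of `L` equally strong paths. -/
def ringCov (D Δ : ℝ) (L : ℕ) (θ : ℝ) (n : ℕ) : Matrix (Fin n) (Fin n) ℂ :=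
  Matrix.of fun a b => (1 / (2 * Δ * L) : ℂ) * ∫ t in (θ - Δ)..(θ + Δ),
    Complex.exp (-Complex.I * 2 * Real.pi * D * ((a : ℂ) - (b : ℂ)) * Real.sin t)

theorem ringCov_isHermitian (D Δ : ℝ) (L : ℕ) (θ : ℝ) (n : ℕ) :
    (ringCov D Δ L θ n).IsHermitian := by
  ext a b
  simp only [ringCov, Matrix.conjTranspose_apply, Matrix.of_apply, RCLike.star_def, map_mul]
  congr 1
  · simp [map_ofNat]
  · simp only [intervalIntegral.intervalIntegral_eq_integral_uIoc, Complex.real_smul, map_mul,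
      Complex.conj_ofReal, ← integral_conj, ← Complex.exp_conj]
    congr 2
    ext t
    congr 1
    simp only [map_neg, map_sub, Complex.conj_I, map_natCast,
      map_ofNat]
    ring

/-- The rows, indexed by the subcarriers `p 0, …, p (s-1)`, of the first `L` columns of the
unnormalized DFT matrix of size `N`. -/
def dftRows (N L : ℕ) {s : ℕ} (p : Fin s → Fin N) : Matrix (Fin s) (Fin L) ℂ :=
  Matrix.of fun k l => Complex.exp (-Complex.I * 2 * Real.pi * (p k : ℕ) * (l : ℕ) / N)

/-- The frequency covariance `R_F = F^* F^T`. -/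
def freqCov {s L : ℕ} (F : Matrix (Fin s) (Fin L) ℂ) : Matrix (Fin s) (Fin s) ℂ :=
  (Fᵀ)ᴴ * Fᵀ

theorem freqCov_isHermitian {s L : ℕ} (F : Matrix (Fin s) (Fin L) ℂ) :
    (freqCov F).IsHermitian :=
  Matrix.isHermitian_conjTranspose_mul_self _

/-- `U diag(√λ) U^H` for a Hermitian matrix `A = U diag(λ) U^H`: the positive semidefinite square
root when `A` is positive semidefinite. -/
def hermSqrt {n : ℕ} {A : Matrix (Fin n) (Fin n) ℂ} (hA : A.IsHermitian) :
    Matrix (Fin n) (Fin n) ℂ :=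
  hA.cfc Real.sqrt

/-- `U diag(λ̄) U^H` for a Hermitian matrix `A = U diag(λ) U^H`, where `λ̄ = 1/λ` on the eigenvalues
`λ ≥ τ` and `λ̄ = 0` on the others. -/
def truncInv {n : ℕ} {A : Matrix (Fin n) (Fin n) ℂ} (hA : A.IsHermitian) (τ : ℝ) :
    Matrix (Fin n) (Fin n) ℂ :=
  hA.cfc (fun x => if τ ≤ x then x⁻¹ else 0)

/-- The number, with multiplicity, of the eigenvalues `λ ≥ τ` of a Hermitian matrix. -/
def effRank {n : ℕ} {A : Matrix (Fin n) (Fin n) ℂ} (hA : A.IsHermitian) (τ : ℝ) : ℕ :=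
  (Finset.univ.filter fun i => τ ≤ hA.eigenvalues i).card

/-- `U diag(λ̄) U^H` for a Hermitian matrix `A = U diag(λ) U^H`, where `λ̄ = 1/λ` if `λ ≠ 0` and
`λ̄ = 0` if `λ = 0`: the Moore-Penrose inverse. -/
def pseudoInv {n : ℕ} {A : Matrix (Fin n) (Fin n) ℂ} (hA : A.IsHermitian) :
    Matrix (Fin n) (Fin n) ℂ :=
  hA.cfc (fun x => x⁻¹)

/-- The frequency-selective channel, a row vector `g (R^{1/2} ⊗ F^T)`. -/
def fsChannel {n s L : ℕ} {R : Matrix (Fin n) (Fin n) ℂ} (hR : R.IsHermitian)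
    (F : Matrix (Fin s) (Fin L) ℂ) (g : Fin n × Fin L → ℂ) : Fin n × Fin s → ℂ :=
  g ᵥ* (hermSqrt hR ⊗ₖ Fᵀ)

/-- The `2 × 2` pilot matrix: rows are the two symbol times, column `0` is Bob's pilot vector
(power `ρB`, phases `φ`), column `1` is Ava's (power `ρA`, phases `ψ`). -/
def pilots (ρB ρA : ℝ) (φ ψ : Fin 2 → ℝ) : Matrix (Fin 2) (Fin 2) ℂ :=
  Matrix.of fun k j =>
    if j = 0 then (Real.sqrt ρB : ℂ) * Complex.exp (Complex.I * φ k)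
    else (Real.sqrt ρA : ℂ) * Complex.exp (Complex.I * ψ k)

/-- The received signal `Y = X H + σ Z`, where the rows of `H` are Bob's and Ava's channels. -/
def received {n s : ℕ} (X : Matrix (Fin 2) (Fin 2) ℂ) (hB hA : Fin n × Fin s → ℂ) (σ : ℝ)
    (Z : Fin 2 × (Fin n × Fin s) → ℂ) : Matrix (Fin 2) (Fin n × Fin s) ℂ :=
  X * Matrix.of ![hB, hA] + (σ : ℂ) • Matrix.of fun k a => Z (k, a)

/-- The sample covariance matrix `C_Y = Y Y^H / (n s)`. -/
def sampleCov {n s : ℕ} (Y : Matrix (Fin 2) (Fin n × Fin s) ℂ) : Matrix (Fin 2) (Fin 2) ℂ :=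
  (1 / ((n : ℂ) * (s : ℂ))) • (Y * Yᴴ)

/-- The channel estimate `W Y` with `W = T x^H C_Y⁻¹`, `T = Tr(R) Tr(R_F) / (n s)`, for the pilot
vector `x` and the spatial covariance `R`. -/
def estimate {n s : ℕ} (R : Matrix (Fin n) (Fin n) ℂ) (RF : Matrix (Fin s) (Fin s) ℂ)
    (x : Fin 2 → ℂ) (Y : Matrix (Fin 2) (Fin n × Fin s) ℂ) : Fin n × Fin s → ℂ :=
  ((R.trace * RF.trace / ((n : ℂ) * (s : ℂ))) • (star x ᵥ* (sampleCov Y)⁻¹)) ᵥ* Y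

/-- The measure `f(r) = r (R̄₁ ⊗ R̄_F) r^H` of a row vector `r`. -/
def fMeasure {n s : ℕ} (R1bar : Matrix (Fin n) (Fin n) ℂ) (RFbar : Matrix (Fin s) (Fin s) ℂ)
    (r : Fin n × Fin s → ℂ) : ℂ :=
  (r ᵥ* (R1bar ⊗ₖ RFbar)) ⬝ᵥ star r

/-- The error decision function, `Δf = f(hatB) - f(hatA)`, for spatial covariance `R₁` with
eigenvalue threshold `τ`. -/
def deltaF {n s L : ℕ} {R1 : Matrix (Fin n) (Fin n) ℂ} (hR1 : R1.IsHermitian) (τ : ℝ)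
    (F : Matrix (Fin s) (Fin L) ℂ) (hatB hatA : Fin n × Fin s → ℂ) : ℂ :=
  fMeasure (truncInv hR1 τ) (pseudoInv (freqCov_isHermitian F)) hatB -
    fMeasure (truncInv hR1 τ) (pseudoInv (freqCov_isHermitian F)) hatA

/-- The claimed value `L (ρ₁ - Tr(R₂ R̄₁))`. -/
def deltaFLimit {n : ℕ} (L : ℕ) {R1 : Matrix (Fin n) (Fin n) ℂ} (hR1 : R1.IsHermitian) (τ : ℝ)
    (R2 : Matrix (Fin n) (Fin n) ℂ) : ℂ :=
  (L : ℂ) * ((effRank hR1 τ : ℂ) - (R2 * truncInv hR1 τ).trace)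

end PilotID

end

/-!
With `n` antennas, the rows of the received signal are combinations of Gaussian vectors acted on by
matrices of bounded norm. Fourth moments and the Borel–Cantelli lemma show that almost surely the
Gram matrix of these images, divided by `n`, is asymptotically the diagonal matrix of its
expectations. In the first situation `Tₖ = 1` and the combiner `xₖᴴ C⁻¹ X` tends to the unit row
vector `eₖ`, so both estimates behave like the channels themselves. In the second situation the
error adds the same energy to both sides, which cancels in the difference. The covariances are
bounded in operator norm because the substitution `u = D sin θ` turns their quadratic forms into
integrals of squared trigonometric polynomials, to which Parseval's identity applies.
-/

namespace PilotID

lemma measurable_mk_complex : Measurable (fun p : ℝ × ℝ => (⟨p.1, p.2⟩ : ℂ)) :=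
  Complex.measurableEquivRealProd.symm.measurable

instance isGaussian_cn01 : IsGaussian cn01 :=
  inferInstanceAs (IsGaussian (((gaussianReal 0 (1 / 2)).prod (gaussianReal 0 (1 / 2))).map
    (Complex.equivRealProdCLM.symm : (ℝ × ℝ) →L[ℝ] ℂ)))

lemma charFun_cn01 (t : ℂ) : charFun cn01 t = Complex.exp (-(‖t‖ ^ 2 / 4)) := by
  have exp_inner (p : ℝ × ℝ) : Complex.exp ((inner ℝ (⟨p.1, p.2⟩ : ℂ) t : ℝ) * Complex.I) =
      Complex.exp (t.re * p.1 * Complex.I) * Complex.exp (t.im * p.2 * Complex.I) := by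
    rw [← Complex.exp_add, Complex.inner]
    congr 1
    simp only [Complex.mul_re, Complex.conj_re, Complex.conj_im]
    push_cast
    ring
  rw [charFun_apply, cn01, integral_map measurable_mk_complex.aemeasurable (by fun_prop)]
  simp_rw [exp_inner]
  rw [integral_prod_mul (fun x : ℝ => Complex.exp (t.re * x * Complex.I))
    (fun x : ℝ => Complex.exp (t.im * x * Complex.I)), ← charFun_apply_real, ← charFun_apply_real,
    charFun_gaussianReal, charFun_gaussianReal, ← Complex.exp_add, ← Complex.ofReal_pow ‖t‖,
    Complex.sq_norm, Complex.normSq_apply]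
  congr 1
  push_cast
  ring

lemma integral_normSq_cn01 : ∫ z, ‖z‖ ^ 2 ∂cn01 = 1 := by
  have secondMoment : ∫ x, x ^ 2 ∂(gaussianReal 0 (1 / 2)) = 1 / 2 := by
    rw [← variance_of_integral_eq_zero (by fun_prop) integral_id_gaussianReal,
      variance_fun_id_gaussianReal]
    norm_num
  have hint : Integrable (fun x : ℝ => x ^ 2) (gaussianReal 0 (1 / 2)) :=
    (memLp_id_gaussianReal 2).integrable_sq
  rw [cn01, integral_map measurable_mk_complex.aemeasurable (by fun_prop)]
  simp only [Complex.sq_norm, Complex.normSq_mk, ← pow_two]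
  rw [integral_add (hint.comp_fst _) (hint.comp_snd _), integral_fun_fst (fun x : ℝ => x ^ 2),
    integral_fun_snd (fun x : ℝ => x ^ 2), secondMoment]
  norm_num

lemma integral_normSq_sub_one_cn01 : ∫ z, (‖z‖ ^ 2 - 1) ∂cn01 = 0 := by
  have hint : Integrable (fun z => ‖z‖ ^ 2) cn01 :=
    (IsGaussian.memLp_id cn01 2 (by simp)).integrable_norm_pow two_ne_zero
  rw [integral_sub hint (integrable_const _), integral_normSq_cn01]
  simp

lemma memLp_normSq_sub_one_cn01 : MemLp (fun z : ℂ => ‖z‖ ^ 2 - 1) 4 cn01 := by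
  have norm_mem : MemLp (fun z : ℂ => ‖z‖) 8 cn01 := (IsGaussian.memLp_id cn01 8 (by simp)).norm
  have : ENNReal.HolderTriple 8 8 4 := ⟨by
    rw [← two_mul, show (8 : ENNReal) = 2 * 4 by norm_num,
      ENNReal.mul_inv (by simp) (by simp), ← mul_assoc,
      ENNReal.mul_inv_cancel (by simp) (by simp), one_mul]⟩
  simp_rw [pow_two]
  exact (norm_mem.mul norm_mem).sub (memLp_const 1)

lemma charFun_map_toLp_pi_cn01 {ι : Type*} [Fintype ι] (t : EuclideanSpace ℂ ι) :
    charFun ((Measure.pi fun _ : ι => cn01).map (WithLp.toLp 2)) t =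
      Complex.exp (-(‖t‖ ^ 2 / 4)) := by
  rw [charFun_pi]
  simp_rw [charFun_cn01]
  rw [← Complex.exp_sum, Finset.sum_neg_distrib, ← Finset.sum_div, ← Complex.ofReal_pow,
    EuclideanSpace.norm_sq_eq]
  push_cast
  rfl

lemma map_linearIsometryEquiv_pi_cn01 {ι : Type*} [Fintype ι]
    (u : EuclideanSpace ℂ ι ≃ₗᵢ[ℝ] EuclideanSpace ℂ ι) :
    (Measure.pi fun _ : ι => cn01).map (fun x => WithLp.ofLp (u (WithLp.toLp 2 x))) =
      Measure.pi fun _ => cn01 := by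
  have : IsProbabilityMeasure ((Measure.pi fun _ : ι => cn01).map (WithLp.toLp 2)) :=
    Measure.isProbabilityMeasure_map (by fun_prop)
  have hu : Measurable u := u.continuous.measurable
  have map_eq : ((Measure.pi fun _ : ι => cn01).map (WithLp.toLp 2)).map u =
      (Measure.pi fun _ : ι => cn01).map (WithLp.toLp 2) := by
    refine Measure.ext_of_charFun (funext fun t => ?_)
    rw [charFun_apply, integral_map (by fun_prop) (by fun_prop)]
    simp_rw [LinearIsometryEquiv.inner_map_eq_flip]
    rw [← charFun_apply, charFun_map_toLp_pi_cn01, charFun_map_toLp_pi_cn01,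
      LinearIsometryEquiv.norm_map]
  have := congrArg (Measure.map (WithLp.ofLp (V := ι → ℂ))) map_eq
  rw [Measure.map_map (by fun_prop) (by fun_prop), Measure.map_map (by fun_prop) (by fun_prop),
    Measure.map_map (by fun_prop) (by fun_prop)] at this
  exact this.trans Measure.map_id

section IsIIDCN

variable {Ω ι κ : Type*} [MeasurableSpace Ω] {μ : Measure Ω}

lemma IsIIDCN.aemeasurable {X : ι → Ω → ℂ} (h : IsIIDCN X μ) (i : ι) : AEMeasurable (X i) μ :=
  (h.1 i).aemeasurable

lemma IsIIDCN.precomp {X : ι → Ω → ℂ} (h : IsIIDCN X μ) {e : κ → ι}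
    (he : Function.Injective e) : IsIIDCN (fun k => X (e k)) μ :=
  ⟨fun k => h.1 (e k), h.2.precomp he⟩

lemma isIIDCN_iff_map_eq_pi [Fintype ι] [IsProbabilityMeasure μ] {X : ι → Ω → ℂ}
    (hX : ∀ i, AEMeasurable (X i) μ) :
    IsIIDCN X μ ↔ μ.map (fun ω i => X i ω) = Measure.pi fun _ => cn01 := by
  refine ⟨fun h => ?_, fun h => ?_⟩
  · rw [h.2.map_fun_eq_pi_map hX]
    simp_rw [(h.1 _).map_eq]
  · have map_eq (i : ι) : μ.map (X i) = cn01 := by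
      rw [← (measurePreserving_eval (fun _ : ι => cn01) i).map_eq, ← h,
        AEMeasurable.map_map_of_aemeasurable (measurable_pi_apply i).aemeasurable (by fun_prop)]
      rfl
    refine ⟨fun i => ⟨hX i, map_eq i⟩, (iIndepFun_iff_map_fun_eq_pi_map hX).2 ?_⟩
    simp_rw [h, map_eq]

lemma IsIIDCN.vecMul_unitary [Fintype ι] [DecidableEq ι] [IsProbabilityMeasure μ]
    {X : ι → Ω → ℂ} (h : IsIIDCN X μ) {U : Matrix ι ι ℂ} (hU : U ∈ Matrix.unitaryGroup ι ℂ) :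
    IsIIDCN (fun i ω => ((X · ω) ᵥ* U) i) μ := by
  have hX := h.aemeasurable
  have hUt : Uᵀ ∈ Matrix.unitaryGroup ι ℂ := Matrix.transpose_mem_unitaryGroup_iff.2 hU
  let u := Unitary.linearIsometryEquiv
    ⟨_, Unitary.map_mem (Matrix.toEuclideanCLM (n := ι) (𝕜 := ℂ)) hUt⟩
  have vecMul_eq (x : ι → ℂ) : WithLp.ofLp (u (WithLp.toLp 2 x)) = x ᵥ* U :=
    Matrix.mulVec_transpose U x
  have map_eq := map_linearIsometryEquiv_pi_cn01 ⟨u.toLinearEquiv.restrictScalars ℝ, u.norm_map⟩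
  change Measure.map (fun x => WithLp.ofLp (u (WithLp.toLp 2 x))) _ = _ at map_eq
  simp_rw [vecMul_eq] at map_eq
  have hU_meas : Measurable fun x : ι → ℂ => x ᵥ* U :=
    (Continuous.matrix_vecMul continuous_id continuous_const).measurable
  refine (isIIDCN_iff_map_eq_pi fun i => by fun_prop).2 ?_
  conv_rhs => rw [← map_eq, ← (isIIDCN_iff_map_eq_pi hX).1 h,
    AEMeasurable.map_map_of_aemeasurable hU_meas.aemeasurable (by fun_prop)]
  rfl

end IsIIDCN

section FourthMoment

variable {Ω : Type*} [MeasurableSpace Ω] {μ : Measure Ω}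

lemma integrable_pow_of_memLp [IsFiniteMeasure μ] {X : Ω → ℝ} {p k : ℕ} (hX : MemLp X p μ)
    (hk : k ≤ p) : Integrable (fun ω => X ω ^ k) μ := by
  have := (hX.mono_exponent (Nat.cast_le.2 hk)).integrable_norm_pow'
  exact this.mono' (hX.1.pow k) (ae_of_all _ fun ω => by simp)

lemma integral_add_pow_four_of_indepFun [IsProbabilityMeasure μ] {X Y : Ω → ℝ} (h : X ⟂ᵢ[μ] Y)
    (hX : MemLp X 4 μ) (hY : MemLp Y 4 μ) (hX0 : ∫ ω, X ω ∂μ = 0) (hY0 : ∫ ω, Y ω ∂μ = 0) :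
    ∫ ω, (X ω + Y ω) ^ 4 ∂μ = ∫ ω, X ω ^ 4 ∂μ + 6 * ((∫ ω, X ω ^ 2 ∂μ) * ∫ ω, Y ω ^ 2 ∂μ)
      + ∫ ω, Y ω ^ 4 ∂μ := by
  have hXi (k : ℕ) (hk : k ≤ 4) := integrable_pow_of_memLp hX hk
  have hYi (k : ℕ) (hk : k ≤ 4) := integrable_pow_of_memLp hY hk
  have indep (k l : ℕ) : (fun ω => X ω ^ k) ⟂ᵢ[μ] fun ω => Y ω ^ l :=
    h.comp (φ := fun x => x ^ k) (ψ := fun x => x ^ l) (by fun_prop) (by fun_prop)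
  have integral_mul (k l : ℕ) (hk : k ≤ 4) (hl : l ≤ 4) :
      ∫ ω, X ω ^ k * Y ω ^ l ∂μ = (∫ ω, X ω ^ k ∂μ) * ∫ ω, Y ω ^ l ∂μ :=
    (indep k l).integral_fun_mul_eq_mul_integral (hXi k hk).1 (hYi l hl).1
  have integrable_mul (k l : ℕ) (hk : k ≤ 4) (hl : l ≤ 4) :
      Integrable (fun ω => X ω ^ k * Y ω ^ l) μ := (indep k l).integrable_mul (hXi k hk) (hYi l hl)
  simp_rw [add_pow]
  rw [integral_finsetSum _ fun m hm => ((integrable_mul m (4 - m)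
    (by have := Finset.mem_range.1 hm; lia) (by lia)).mul_const _)]
  simp only [integral_mul_const]
  rw [Finset.sum_congr rfl fun m hm => by
    rw [integral_mul m (4 - m) (by have := Finset.mem_range.1 hm; lia) (by lia)]]
  simp [Finset.sum_range_succ, hX0, hY0, Nat.choose]
  ring

lemma sq_integral_sq_le [IsProbabilityMeasure μ] {X : Ω → ℝ} (hX : MemLp X 4 μ) :
    (∫ ω, X ω ^ 2 ∂μ) ^ 2 ≤ ∫ ω, X ω ^ 4 ∂μ := by
  have := ConvexOn.map_integral_le (f := fun ω => X ω ^ 2) (g := fun x => x ^ 2) (μ := μ)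
    (even_two.convexOn_pow (𝕜 := ℝ)) (by fun_prop) isClosed_univ (by simp)
    (integrable_pow_of_memLp hX (by norm_num))
    (by simpa [Function.comp_def, ← pow_mul] using integrable_pow_of_memLp hX le_rfl)
  simpa [← pow_mul] using this

lemma integral_sum_pow_four_le [IsProbabilityMeasure μ] {ι : Type*} {η : ι → Ω → ℝ} {v : ι → ℝ}
    (hind : iIndepFun η μ) (hη : ∀ i, MemLp (η i) 4 μ) (hη0 : ∀ i, ∫ ω, η i ω ∂μ = 0)
    (hv : ∀ i, 0 ≤ v i) (hηv : ∀ i, ∫ ω, η i ω ^ 4 ∂μ ≤ v i ^ 2) (s : Finset ι) :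
    ∫ ω, (∑ i ∈ s, η i ω) ^ 4 ∂μ ≤ 3 * (∑ i ∈ s, v i) ^ 2 := by
  classical
  have secondMoment_le (i : ι) : ∫ ω, η i ω ^ 2 ∂μ ≤ v i :=
    abs_le_of_sq_le_sq' ((sq_integral_sq_le (hη i)).trans (hηv i)) (hv i) |>.2
  have memLp_two (i : ι) : MemLp (η i) 2 μ := (hη i).mono_exponent (by norm_num)
  have sum_zero (s : Finset ι) : ∫ ω, (∑ i ∈ s, η i ω) ∂μ = 0 := by
    rw [integral_finsetSum _ fun i _ => (memLp_two i).integrable one_le_two]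
    simp [hη0]
  have sum_sq (s : Finset ι) : ∫ ω, (∑ i ∈ s, η i ω) ^ 2 ∂μ = ∑ i ∈ s, ∫ ω, η i ω ^ 2 ∂μ := by
    have := IndepFun.variance_sum (s := s) (fun i _ => memLp_two i)
      fun i _ j _ hij => hind.indepFun hij
    rw [variance_of_integral_eq_zero (memLp_finsetSum' s fun i _ => memLp_two i).1.aemeasurable
      (by simpa using sum_zero s)] at this
    simp_rw [variance_of_integral_eq_zero (hη _).1.aemeasurable (hη0 _)] at this
    simpa using this
  induction s using Finset.induction_on with
  | empty => simp
  | insert a s ha ih =>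
    have indep : (η a) ⟂ᵢ[μ] fun ω => ∑ i ∈ s, η i ω := by
      simpa [Finset.sum_fn] using
        (hind.indepFun_finsetSum_of_notMem₀ (fun i => (hη i).1.aemeasurable) ha).symm
    have sq_sum_le : ∑ i ∈ s, ∫ ω, η i ω ^ 2 ∂μ ≤ ∑ i ∈ s, v i :=
      Finset.sum_le_sum fun i _ => secondMoment_le i
    have cross_le : (∫ ω, η a ω ^ 2 ∂μ) * ∫ ω, (∑ i ∈ s, η i ω) ^ 2 ∂μ ≤
        v a * ∑ i ∈ s, v i := by
      rw [sum_sq]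
      exact mul_le_mul (secondMoment_le a) sq_sum_le
        (Finset.sum_nonneg fun i _ => integral_nonneg fun ω => sq_nonneg _) (hv a)
    simp_rw [Finset.sum_insert ha]
    rw [integral_add_pow_four_of_indepFun indep (hη a) (memLp_finsetSum s fun i _ => hη i)
      (hη0 a) (sum_zero s)]
    nlinarith [hηv a, sq_nonneg (v a)]

end FourthMoment

section HermitianFunctionalCalculus

variable {ι : Type*} [Fintype ι] [DecidableEq ι] {A : Matrix ι ι ℂ} (hA : A.IsHermitian)
include hA

lemma cfc_eq_mul_diagonal_mul (f : ℝ → ℝ) :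
    hA.cfc f = (hA.eigenvectorUnitary : Matrix ι ι ℂ) *
      Matrix.diagonal (fun i => (f (hA.eigenvalues i) : ℂ)) *
        (hA.eigenvectorUnitary : Matrix ι ι ℂ)ᴴ :=
  rfl

lemma cfc_id_eq : hA.cfc id = A := by
  rw [← hA.cfc_eq, cfc_id ℝ A hA.isSelfAdjoint]

lemma trace_cfc (f : ℝ → ℝ) : (hA.cfc f).trace = ∑ i, (f (hA.eigenvalues i) : ℂ) := by
  have hU : (hA.eigenvectorUnitary : Matrix ι ι ℂ)ᴴ * hA.eigenvectorUnitary = 1 :=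
    Matrix.mem_unitaryGroup_iff'.1 hA.eigenvectorUnitary.2
  rw [cfc_eq_mul_diagonal_mul, Matrix.trace_mul_cycle, hU, one_mul, Matrix.trace_diagonal]

lemma cfc_mul_cfc (f g : ℝ → ℝ) : hA.cfc f * hA.cfc g = hA.cfc fun x => f x * g x := by
  have continuousOn (f : ℝ → ℝ) : ContinuousOn f (spectrum ℝ A) :=
    A.finite_real_spectrum.continuousOn f
  simp_rw [← hA.cfc_eq]
  exact (cfc_mul f g A (continuousOn f) (continuousOn g)).symm

lemma sum_sq_eigenvalues : ∑ i, hA.eigenvalues i ^ 2 = ∑ i, ∑ j, ‖A i j‖ ^ 2 := by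
  have trace_sq : (A * A).trace = ∑ i, (hA.eigenvalues i : ℂ) ^ 2 := by
    nth_rewrite 1 2 [← cfc_id_eq hA]
    rw [cfc_mul_cfc, trace_cfc]
    simp [pow_two]
  have trace_mul_conjTranspose : (A * Aᴴ).trace = ∑ i, ∑ j, (‖A i j‖ : ℂ) ^ 2 := by
    simp [Matrix.trace, Matrix.mul_apply, Complex.mul_conj']
  rw [hA.eq] at trace_mul_conjTranspose
  exact_mod_cast trace_sq.symm.trans trace_mul_conjTranspose

end HermitianFunctionalCalculus

section QuadraticForm

variable {Ω ι κ : Type*} [MeasurableSpace Ω] {μ : Measure Ω} [Fintype ι] [Fintype κ]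

lemma aemeasurable_vecMul_dotProduct_star {X : ι → Ω → ℂ} {Y : κ → Ω → ℂ}
    (hX : ∀ i, AEMeasurable (X i) μ) (hY : ∀ i, AEMeasurable (Y i) μ) (A : Matrix ι κ ℂ) :
    AEMeasurable (fun ω => ((X · ω) ᵥ* A) ⬝ᵥ star (Y · ω)) μ := by
  simp only [Matrix.vecMul, dotProduct, Pi.star_apply]
  refine Finset.aemeasurable_fun_sum _ fun j _ => AEMeasurable.mul ?_ ?_
  · exact Finset.aemeasurable_fun_sum _ fun i _ => (hX i).mul_const _
  · exact continuous_star.measurable.comp_aemeasurable (hY j)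

lemma vecMul_dotProduct_star_sub_trace [DecidableEq ι] {A : Matrix ι ι ℂ} (hA : A.IsHermitian)
    (x : ι → ℂ) : (x ᵥ* A) ⬝ᵥ star x - A.trace = ((∑ i, hA.eigenvalues i *
      (‖(x ᵥ* (hA.eigenvectorUnitary : Matrix ι ι ℂ)) i‖ ^ 2 - 1) : ℝ) : ℂ) := by
  set U : Matrix ι ι ℂ := ↑hA.eigenvectorUnitary
  have hUA : A = U * Matrix.diagonal (fun i => (hA.eigenvalues i : ℂ)) * Uᴴ :=
    (cfc_id_eq hA).symm
  rw [hA.trace_eq_sum_eigenvalues]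
  nth_rewrite 1 [hUA]
  rw [← Matrix.vecMul_vecMul, ← Matrix.vecMul_vecMul, ← Matrix.dotProduct_mulVec,
    ← Matrix.star_vecMul]
  simp only [dotProduct, Matrix.vecMul_diagonal, Pi.star_apply, RCLike.star_def]
  push_cast
  rw [← Finset.sum_sub_distrib]
  refine Finset.sum_congr rfl fun i _ => ?_
  rw [← Complex.mul_conj', RCLike.ofReal_eq_complex_ofReal]
  ring

lemma lintegral_vecMul_dotProduct_star_sub_trace_pow_four_le [IsProbabilityMeasure μ]
    {X : ι → Ω → ℂ} (hX : IsIIDCN X μ) {A : Matrix ι ι ℂ} (hA : A.IsHermitian) :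
    ∫⁻ ω, ‖((X · ω) ᵥ* A) ⬝ᵥ star (X · ω) - A.trace‖ₑ ^ 4 ∂μ ≤ ENNReal.ofReal
      (3 * (∫ z, (‖z‖ ^ 2 - 1) ^ 4 ∂cn01) * (∑ i, ∑ j, ‖A i j‖ ^ 2) ^ 2) := by
  classical
  set l := hA.eigenvalues
  set Y : ι → Ω → ℂ := fun i ω => ((X · ω) ᵥ* (hA.eigenvectorUnitary : Matrix ι ι ℂ)) i
  have hY : IsIIDCN Y μ := hX.vecMul_unitary hA.eigenvectorUnitary.2
  set η : ι → Ω → ℝ := fun i ω => l i * (‖Y i ω‖ ^ 2 - 1)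
  set m := ∫ z, (‖z‖ ^ 2 - 1) ^ 4 ∂cn01
  have hm : 0 ≤ m := integral_nonneg fun z => by positivity
  have hη (i : ι) : MemLp (η i) 4 μ := by
    have := memLp_normSq_sub_one_cn01
    rw [← (hY.1 i).map_eq] at this
    exact (this.comp_of_map (hY.aemeasurable i)).const_mul (l i)
  have hη0 (i : ι) : ∫ ω, η i ω ∂μ = 0 := by
    have := (hY.1 i).integral_comp (f := fun z : ℂ => ‖z‖ ^ 2 - 1) (by fun_prop)
    simp only [Function.comp_def] at this
    rw [integral_const_mul, this, integral_normSq_sub_one_cn01, mul_zero]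
  have hη4 (i : ι) : ∫ ω, η i ω ^ 4 ∂μ = (√m * l i ^ 2) ^ 2 := by
    have := (hY.1 i).integral_comp (f := fun z : ℂ => (‖z‖ ^ 2 - 1) ^ 4) (by fun_prop)
    simp only [Function.comp_def] at this
    simp_rw [η, mul_pow]
    rw [integral_const_mul, this, Real.sq_sqrt hm]
    ring
  have hind : iIndepFun η μ :=
    hY.2.comp (fun i z => l i * (‖z‖ ^ 2 - 1)) fun i => by fun_prop
  have enorm_eq (ω : Ω) : ‖((X · ω) ᵥ* A) ⬝ᵥ star (X · ω) - A.trace‖ₑ ^ 4 =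
      ENNReal.ofReal ((∑ i, η i ω) ^ 4) := by
    rw [vecMul_dotProduct_star_sub_trace hA, ← ofReal_norm, ← ENNReal.ofReal_pow (norm_nonneg _),
      Complex.norm_real, Real.norm_eq_abs, Even.pow_abs (by decide)]
  simp_rw [enorm_eq]
  rw [← ofReal_integral_eq_lintegral_ofReal
    (integrable_pow_of_memLp (memLp_finsetSum _ fun i _ => hη i) le_rfl)
    (ae_of_all _ fun ω => Even.pow_nonneg (by decide) _)]
  refine ENNReal.ofReal_le_ofReal ?_
  calc ∫ ω, (∑ i, η i ω) ^ 4 ∂μ ≤ 3 * (∑ i, √m * l i ^ 2) ^ 2 :=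
        integral_sum_pow_four_le hind hη hη0 (fun i => by positivity) (fun i => (hη4 i).le) _
    _ = 3 * m * (∑ i, ∑ j, ‖A i j‖ ^ 2) ^ 2 := by
      rw [← Finset.mul_sum, sum_sq_eigenvalues, mul_pow, Real.sq_sqrt hm, mul_assoc]

end QuadraticForm

lemma ae_tendsto_zero_of_tsum_lintegral_pow_ne_top {Ω E : Type*} [MeasurableSpace Ω]
    {μ : Measure Ω} [NormedAddCommGroup E] {f : ℕ → Ω → E}
    (hf : ∀ n, AEStronglyMeasurable (f n) μ) {k : ℕ} (hk : k ≠ 0)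
    (hsum : ∑' n, ∫⁻ ω, ‖f n ω‖ₑ ^ k ∂μ ≠ ⊤) : ∀ᵐ ω ∂μ, Tendsto (f · ω) atTop (𝓝 0) := by
  have hmeas (n : ℕ) : AEMeasurable (fun ω => ‖f n ω‖ₑ ^ k) μ := (hf n).enorm.pow_const k
  rw [← lintegral_tsum hmeas] at hsum
  filter_upwards [ae_lt_top' (AEMeasurable.tsum hmeas) hsum] with ω hω
  have := (ENNReal.tendsto_atTop_zero_of_tsum_ne_top hω.ne).ennrpow_const (k : ℝ)⁻¹
  rw [tendsto_zero_iff_enorm_tendsto_zero]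
  simpa [ENNReal.zero_rpow_of_pos, hk, Nat.pos_of_ne_zero, ENNReal.pow_rpow_inv_natCast] using this

lemma ae_tendsto_div_of_lintegral_pow_four_le {Ω : Type*} [MeasurableSpace Ω] {μ : Measure Ω}
    {f : ℕ → Ω → ℂ} (hf : ∀ n, AEMeasurable (f n) μ) {K : ℝ}
    (hK : ∀ n, ∫⁻ ω, ‖f n ω‖ₑ ^ 4 ∂μ ≤ ENNReal.ofReal (K * (n : ℝ) ^ 2)) :
    ∀ᵐ ω ∂μ, Tendsto (fun n : ℕ => f n ω / n) atTop (𝓝 0) := by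
  have lintegral_le (n : ℕ) :
      ∫⁻ ω, ‖f n ω / n‖ₑ ^ 4 ∂μ ≤ ENNReal.ofReal (K * ((n : ℝ) ^ 2)⁻¹) := by
    have enorm_inv : ‖(n : ℂ)⁻¹‖ₑ ^ 4 = ENNReal.ofReal (((n : ℝ) ^ 4)⁻¹) := by
      rw [← ofReal_norm, ← ENNReal.ofReal_pow (norm_nonneg _)]
      simp
    simp_rw [div_eq_mul_inv, enorm_mul, mul_pow, enorm_inv]
    rw [lintegral_mul_const'' _ ((hf n).enorm.pow_const 4)]
    calc _ ≤ ENNReal.ofReal (K * (n : ℝ) ^ 2) * ENNReal.ofReal (((n : ℝ) ^ 4)⁻¹) := by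
          gcongr
          exact hK n
      _ = ENNReal.ofReal (K * ((n : ℝ) ^ 2)⁻¹) := by
        rw [← ENNReal.ofReal_mul' (by positivity)]
        congr 1
        rcases n.eq_zero_or_pos with rfl | hn
        · simp
        · field_simp
  refine ae_tendsto_zero_of_tsum_lintegral_pow_ne_top
    (fun n => ((hf n).div_const _).aestronglyMeasurable) four_ne_zero
    (ne_top_of_le_ne_top ?_ (ENNReal.tsum_le_tsum lintegral_le))
  exact ((Real.summable_nat_pow_inv.2 one_lt_two).mul_left K).tsum_ofReal_ne_top

section RealImaginaryPart

open scoped Matrix.Norms.Frobenius ComplexStarModule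

variable {ι : Type*} [Fintype ι]

lemma sum_normSq_eq_frobenius_norm_sq (A : Matrix ι ι ℂ) :
    ∑ i, ∑ j, ‖A i j‖ ^ 2 = ‖A‖ ^ 2 := by
  simp_rw [Matrix.frobenius_norm_def, Real.rpow_two]
  rw [← Real.sqrt_eq_rpow, Real.sq_sqrt (by positivity)]

lemma sum_normSq_realPart_le (A : Matrix ι ι ℂ) :
    ∑ i, ∑ j, ‖(ℜ A : Matrix ι ι ℂ) i j‖ ^ 2 ≤ ∑ i, ∑ j, ‖A i j‖ ^ 2 := by
  simp_rw [sum_normSq_eq_frobenius_norm_sq]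
  gcongr
  exact realPart.norm_le A

lemma sum_normSq_imaginaryPart_le (A : Matrix ι ι ℂ) :
    ∑ i, ∑ j, ‖(ℑ A : Matrix ι ι ℂ) i j‖ ^ 2 ≤ ∑ i, ∑ j, ‖A i j‖ ^ 2 := by
  simp_rw [sum_normSq_eq_frobenius_norm_sq]
  gcongr
  exact imaginaryPart.norm_le A

end RealImaginaryPart

section Concentration

variable {Ω : Type*} [MeasurableSpace Ω] {μ : Measure Ω} [IsProbabilityMeasure μ]
  {ι κ : ℕ → Type*} [∀ n, Fintype (ι n)] [∀ n, Fintype (κ n)] {K : ℝ}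

lemma ae_tendsto_quadForm_of_isHermitian {X : ∀ n, ι n → Ω → ℂ} (hX : ∀ n, IsIIDCN (X n) μ)
    {A : ∀ n, Matrix (ι n) (ι n) ℂ} (hA : ∀ n, (A n).IsHermitian)
    (hK : ∀ n, ∑ i, ∑ j, ‖A n i j‖ ^ 2 ≤ K * n) :
    ∀ᵐ ω ∂μ, Tendsto (fun n : ℕ => (((X n · ω) ᵥ* A n) ⬝ᵥ star (X n · ω) - (A n).trace) / n)
      atTop (𝓝 0) := by
  have : 0 ≤ ∫ z, (‖z‖ ^ 2 - 1) ^ 4 ∂cn01 :=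
    integral_nonneg fun z => Even.pow_nonneg (by decide) _
  refine ae_tendsto_div_of_lintegral_pow_four_le
    (K := 3 * (∫ z, (‖z‖ ^ 2 - 1) ^ 4 ∂cn01) * K ^ 2)
    (fun n => (aemeasurable_vecMul_dotProduct_star (hX n).aemeasurable
      (hX n).aemeasurable _).sub_const _) fun n => ?_
  refine (lintegral_vecMul_dotProduct_star_sub_trace_pow_four_le (hX n) (hA n)).trans
    (ENNReal.ofReal_le_ofReal ?_)
  rw [mul_assoc _ (K ^ 2), ← mul_pow]
  gcongr
  exact hK n

open scoped ComplexStarModule in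
lemma ae_tendsto_quadForm {X : ∀ n, ι n → Ω → ℂ} (hX : ∀ n, IsIIDCN (X n) μ)
    {A : ∀ n, Matrix (ι n) (ι n) ℂ} (hK : ∀ n, ∑ i, ∑ j, ‖A n i j‖ ^ 2 ≤ K * n) :
    ∀ᵐ ω ∂μ, Tendsto (fun n : ℕ => (((X n · ω) ᵥ* A n) ⬝ᵥ star (X n · ω) - (A n).trace) / n)
      atTop (𝓝 0) := by
  filter_upwards [
    ae_tendsto_quadForm_of_isHermitian hX (A := fun n => ℜ (A n)) (fun n => (ℜ (A n)).2)
      fun n => (sum_normSq_realPart_le (A n)).trans (hK n),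
    ae_tendsto_quadForm_of_isHermitian hX (A := fun n => ℑ (A n)) (fun n => (ℑ (A n)).2)
      fun n => (sum_normSq_imaginaryPart_le (A n)).trans (hK n)] with ω hre him
  have hlim := hre.add (him.const_mul Complex.I)
  rw [mul_zero, add_zero] at hlim
  refine hlim.congr fun n => ?_
  conv_rhs => rw [← realPart_add_I_smul_imaginaryPart (A n)]
  simp only [Matrix.vecMul_add, Matrix.vecMul_smul, add_dotProduct, smul_dotProduct,
    Matrix.trace_add, Matrix.trace_smul, smul_eq_mul]
  ring

lemma ae_tendsto_sesqForm {X : ∀ n, ι n → Ω → ℂ} {Y : ∀ n, κ n → Ω → ℂ}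
    (hXY : ∀ n, IsIIDCN (Sum.elim (X n) (Y n)) μ) {A : ∀ n, Matrix (ι n) (κ n) ℂ}
    (hK : ∀ n, ∑ i, ∑ j, ‖A n i j‖ ^ 2 ≤ K * n) :
    ∀ᵐ ω ∂μ, Tendsto (fun n : ℕ => (((X n · ω) ᵥ* A n) ⬝ᵥ star (Y n · ω)) / n) atTop (𝓝 0) := by
  filter_upwards [ae_tendsto_quadForm hXY (A := fun n => Matrix.fromBlocks 0 (A n) 0 0)
    (K := K) (by simpa [Fintype.sum_sum_type] using hK)] with ω hω
  refine hω.congr fun n => ?_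
  have elim_eq : (Sum.elim (X n) (Y n) · ω) = Sum.elim (X n · ω) (Y n · ω) := by
    ext (i | i) <;> rfl
  rw [elim_eq, Matrix.vecMul_fromBlocks]
  simp [dotProduct, Matrix.trace, Fintype.sum_sum_type, Function.comp_def]

end Concentration

section OperatorNorm

open scoped Matrix.Norms.L2Operator

variable {m n p q ι : Type*} [Fintype m] [Fintype n] [Fintype p] [Fintype q] [Fintype ι]

section

variable [DecidableEq n]

lemma sum_normSq_mulVec_le (M : Matrix m n ℂ) (x : n → ℂ) :
    ∑ i, ‖(M *ᵥ x) i‖ ^ 2 ≤ ‖M‖ ^ 2 * ∑ j, ‖x j‖ ^ 2 := by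
  have := pow_le_pow_left₀ (norm_nonneg _) (M.l2_opNorm_mulVec (WithLp.toLp 2 x)) 2
  rwa [mul_pow, EuclideanSpace.norm_sq_eq, EuclideanSpace.norm_sq_eq] at this

lemma opNorm_le_of_sum_normSq_mulVec_le {M : Matrix m n ℂ} {K : ℝ} (hK : 0 ≤ K)
    (h : ∀ x : n → ℂ, ∑ i, ‖(M *ᵥ x) i‖ ^ 2 ≤ K ^ 2 * ∑ j, ‖x j‖ ^ 2) : ‖M‖ ≤ K := by
  rw [Matrix.l2_opNorm_def]
  refine ContinuousLinearMap.opNorm_le_bound _ hK fun x => le_of_sq_le_sq ?_ (by positivity)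
  rw [mul_pow, EuclideanSpace.norm_sq_eq, EuclideanSpace.norm_sq_eq]
  exact h x.ofLp

lemma sum_normSq_le_card_mul (M : Matrix m n ℂ) :
    ∑ i, ∑ j, ‖M i j‖ ^ 2 ≤ Fintype.card n * ‖M‖ ^ 2 := by
  have sum_col_le (j : n) : ∑ i, ‖M i j‖ ^ 2 ≤ ‖M‖ ^ 2 := by
    have := sum_normSq_mulVec_le M (Pi.single j 1)
    simpa [Pi.single_apply, apply_ite] using this
  rw [Finset.sum_comm, ← nsmul_eq_mul, ← Finset.card_univ]
  exact Finset.sum_le_card_nsmul _ _ _ fun j _ => sum_col_le j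

end

lemma norm_kronecker_le [DecidableEq n] [DecidableEq q] (A : Matrix m n ℂ) (B : Matrix p q ℂ) :
    ‖A ⊗ₖ B‖ ≤ ‖A‖ * ‖B‖ := by
  refine opNorm_le_of_sum_normSq_mulVec_le (by positivity) fun x => ?_
  have mulVec_apply (i : m) (k : p) :
      ((A ⊗ₖ B) *ᵥ x) (i, k) = (A *ᵥ fun j => (B *ᵥ fun l => x (j, l)) k) i := by
    simp only [Matrix.mulVec, dotProduct, Matrix.kroneckerMap_apply, Fintype.sum_prod_type,
      Finset.mul_sum, mul_assoc]
  rw [Fintype.sum_prod_type, Finset.sum_comm, Fintype.sum_prod_type]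
  calc _ ≤ ∑ k, ‖A‖ ^ 2 * ∑ j, ‖(B *ᵥ fun l => x (j, l)) k‖ ^ 2 := by
        simp_rw [mulVec_apply]
        exact Finset.sum_le_sum fun k _ => sum_normSq_mulVec_le A _
    _ = ‖A‖ ^ 2 * ∑ j, ∑ k, ‖(B *ᵥ fun l => x (j, l)) k‖ ^ 2 := by
        rw [← Finset.mul_sum, Finset.sum_comm]
    _ ≤ ‖A‖ ^ 2 * ∑ j, ‖B‖ ^ 2 * ∑ l, ‖x (j, l)‖ ^ 2 := by
        gcongr with j
        exact sum_normSq_mulVec_le B _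
    _ = _ := by
      rw [← Finset.mul_sum]
      ring

variable [DecidableEq ι]

lemma norm_trace_le_card_mul (M : Matrix ι ι ℂ) : ‖M.trace‖ ≤ Fintype.card ι * ‖M‖ := by
  have norm_diag_le (i : ι) : ‖M i i‖ ≤ ‖M‖ := by
    have := (PiLp.norm_apply_le _ i).trans (M.l2_opNorm_mulVec (EuclideanSpace.single i 1))
    simpa using this
  calc ‖M.trace‖ ≤ ∑ i, ‖M i i‖ := norm_sum_le _ _
    _ ≤ Fintype.card ι • ‖M‖ := Finset.sum_le_card_nsmul _ _ _ fun i _ => norm_diag_le i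
    _ = Fintype.card ι * ‖M‖ := nsmul_eq_mul _ _

end OperatorNorm

/-- The rows of the matrices `V n` are asymptotically orthogonal, with squared norms `t n a`, for
the sesquilinear forms of the matrices `Q n`: their Gram matrix differs from `diag (t n)` by
`o(n)`, entry by entry. -/
def IsAsympOrthogonal {α : Type*} [DecidableEq α] {m : ℕ → Type*} [∀ n, Fintype (m n)]
    (Q : ∀ n, Matrix (m n) (m n) ℂ) (V : ∀ n, Matrix α (m n) ℂ) (t : ℕ → α → ℂ) : Prop :=
  Tendsto (fun n : ℕ => (n : ℂ)⁻¹ • (V n * Q n * (V n)ᴴ - Matrix.diagonal (t n))) atTop (𝓝 0)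

section AsympOrthogonal

variable {α : Type*} {m : ℕ → Type*} [∀ n, Fintype (m n)]
  {Q : ∀ n, Matrix (m n) (m n) ℂ}

lemma vecMul_vecMul_dotProduct_star {ι κ : Type*} [Fintype ι] [Fintype κ] (w : ι → ℂ)
    (A : Matrix ι κ ℂ) (B : Matrix κ κ ℂ) :
    (w ᵥ* A ᵥ* B) ⬝ᵥ star (w ᵥ* A) = (w ᵥ* (A * B * Aᴴ)) ⬝ᵥ star w := by
  rw [Matrix.star_vecMul, Matrix.dotProduct_mulVec, Matrix.vecMul_vecMul, Matrix.vecMul_vecMul,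
    ← Matrix.mul_assoc]

lemma vecMul_diagonal_dotProduct_star [Fintype α] [DecidableEq α] (w t : α → ℂ) :
    (w ᵥ* Matrix.diagonal t) ⬝ᵥ star w = ∑ a, (‖w a‖ : ℂ) ^ 2 * t a := by
  simp only [dotProduct, Matrix.vecMul_diagonal, Pi.star_apply, RCLike.star_def,
    ← Complex.mul_conj', mul_right_comm]

lemma IsAsympOrthogonal.tendsto_vecMul [Fintype α] [DecidableEq α]
    {V : ∀ n, Matrix α (m n) ℂ} {t : ℕ → α → ℂ} (h : IsAsympOrthogonal Q V t)
    {B : ℝ} (ht : ∀ n a, ‖t n a‖ ≤ B * n) {β : Type*}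
    {l : Filter β} {N : β → ℕ} (hN : Tendsto N l atTop) {w : β → α → ℂ} {w₀ : α → ℂ}
    (hw : Tendsto w l (𝓝 w₀)) :
    Tendsto (fun x => ((w x ᵥ* V (N x) ᵥ* Q (N x)) ⬝ᵥ star (w x ᵥ* V (N x)) -
      ∑ a, ‖w₀ a‖ ^ 2 * t (N x) a) / N x) l (𝓝 0) := by
  have offDiagonal : Tendsto (fun x => (w x ᵥ* ((N x : ℂ)⁻¹ • (V (N x) * Q (N x) * (V (N x))ᴴ -
      Matrix.diagonal (t (N x))))) ⬝ᵥ star (w x)) l (𝓝 0) := by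
    have continuous_form : Continuous fun p : (α → ℂ) × Matrix α α ℂ =>
        (p.1 ᵥ* p.2) ⬝ᵥ star p.1 := by fun_prop
    simpa [Function.comp_def] using
      (continuous_form.tendsto (w₀, 0)).comp (hw.prodMk_nhds (h.comp hN))
  have diagonal : Tendsto (fun x => ∑ a, ((‖w x a‖ : ℂ) ^ 2 - ‖w₀ a‖ ^ 2) *
      (t (N x) a / N x)) l (𝓝 0) := by
    have each (a : α) : Tendsto (fun x => ((‖w x a‖ : ℂ) ^ 2 - ‖w₀ a‖ ^ 2) *
        (t (N x) a / N x)) l (𝓝 0) := by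
      refine Tendsto.zero_mul_isBoundedUnder_le ?_ ?_
      · rw [← sub_self ((‖w₀ a‖ : ℂ) ^ 2)]
        exact (((Complex.continuous_ofReal.tendsto _).comp
          (tendsto_pi_nhds.1 hw a).norm).pow 2).sub_const _
      · refine isBoundedUnder_of_eventually_le (a := B) ?_
        filter_upwards [hN.eventually_gt_atTop 0] with x hx
        rw [Function.comp_apply, norm_div, Complex.norm_natCast, div_le_iff₀ (by positivity)]
        exact ht _ a
    simpa using tendsto_finsetSum Finset.univ fun a _ => each a
  refine (add_zero (0 : ℂ) ▸ offDiagonal.add diagonal).congr fun x => ?_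
  simp only [vecMul_vecMul_dotProduct_star, Matrix.vecMul_smul, Matrix.vecMul_sub,
    smul_dotProduct, sub_dotProduct, smul_eq_mul, vecMul_diagonal_dotProduct_star, sub_mul,
    Finset.sum_sub_distrib, mul_div_assoc', ← Finset.sum_div]
  ring

open scoped Matrix.Norms.L2Operator

lemma norm_mul_mul_conjTranspose_le {ι κ ν : Type*} [Fintype ι] [Fintype κ] [Fintype ν]
    [DecidableEq κ] [DecidableEq ν] {S : Matrix ι κ ℂ} {A : Matrix κ κ ℂ}
    {T : Matrix ν κ ℂ} {C C' : ℝ} (hS : ‖S‖ ≤ C) (hA : ‖A‖ ≤ C') (hT : ‖T‖ ≤ C) :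
    ‖S * A * Tᴴ‖ ≤ C * C' * C := by
  classical
  have hC : 0 ≤ C := (norm_nonneg _).trans hS
  have hC' : 0 ≤ C' := (norm_nonneg _).trans hA
  calc ‖S * A * Tᴴ‖ ≤ ‖S‖ * ‖A‖ * ‖Tᴴ‖ :=
        (Matrix.l2_opNorm_mul _ _).trans (by gcongr; exact Matrix.l2_opNorm_mul S A)
    _ ≤ C * C' * C := by
      rw [Matrix.l2_opNorm_conjTranspose]
      gcongr

variable [∀ n, DecidableEq (m n)] {κ : ℕ → α → Type*} [∀ n a, Fintype (κ n a)]
  {T : ∀ n a, Matrix (κ n a) (m n) ℂ} {C C' d : ℝ}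

lemma norm_trace_mul_mul_conjTranspose_le (hT : ∀ n a, ‖T n a‖ ≤ C) (hQ : ∀ n, ‖Q n‖ ≤ C')
    (hd : ∀ n a, (Fintype.card (κ n a) : ℝ) ≤ d * n) (n : ℕ) (a : α) :
    ‖(T n a * Q n * (T n a)ᴴ).trace‖ ≤ d * (C * C' * C) * n := by
  classical
  calc _ ≤ Fintype.card (κ n a) * ‖T n a * Q n * (T n a)ᴴ‖ := norm_trace_le_card_mul _
    _ ≤ d * n * (C * C' * C) := by
      gcongr
      · exact (Nat.cast_nonneg _).trans (hd n a)
      · exact hd n a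
      · exact norm_mul_mul_conjTranspose_le (hT n a) (hQ n) (hT n a)
    _ = d * (C * C' * C) * n := by ring

lemma sum_normSq_mul_mul_conjTranspose_le (hT : ∀ n a, ‖T n a‖ ≤ C) (hQ : ∀ n, ‖Q n‖ ≤ C')
    (hd : ∀ n a, (Fintype.card (κ n a) : ℝ) ≤ d * n) (n : ℕ) (a b : α) :
    ∑ i, ∑ j, ‖(T n a * Q n * (T n b)ᴴ) i j‖ ^ 2 ≤ d * (C * C' * C) ^ 2 * n := by
  classical
  calc _ ≤ Fintype.card (κ n b) * ‖T n a * Q n * (T n b)ᴴ‖ ^ 2 := sum_normSq_le_card_mul _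
    _ ≤ d * n * (C * C' * C) ^ 2 := by
      gcongr
      · exact (Nat.cast_nonneg _).trans (hd n b)
      · exact hd n b
      · exact norm_mul_mul_conjTranspose_le (hT n a) (hQ n) (hT n b)
    _ = d * (C * C' * C) ^ 2 * n := by ring

lemma ae_isAsympOrthogonal [DecidableEq α] [Countable α] {Ω : Type*} [MeasurableSpace Ω]
    {μ : Measure Ω} [IsProbabilityMeasure μ] {X : ∀ n a, κ n a → Ω → ℂ}
    (hX : ∀ n, IsIIDCN (fun i : Σ a, κ n a => X n i.1 i.2) μ) (hT : ∀ n a, ‖T n a‖ ≤ C)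
    (hQ : ∀ n, ‖Q n‖ ≤ C') (hd : ∀ n a, (Fintype.card (κ n a) : ℝ) ≤ d * n) :
    ∀ᵐ ω ∂μ, IsAsympOrthogonal Q (fun n => Matrix.of fun a => (X n a · ω) ᵥ* T n a)
      fun n a => (T n a * Q n * (T n a)ᴴ).trace := by
  classical
  have sum_normSq_le := sum_normSq_mul_mul_conjTranspose_le hT hQ hd
  have entry (a b : α) : ∀ᵐ ω ∂μ, Tendsto (fun n : ℕ => (((X n a · ω) ᵥ*
      (T n a * Q n * (T n b)ᴴ)) ⬝ᵥ star (X n b · ω) -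
      Matrix.diagonal (fun a => (T n a * Q n * (T n a)ᴴ).trace) a b) / n) atTop (𝓝 0) := by
    rcases eq_or_ne a b with rfl | hab
    · simpa only [Matrix.diagonal_apply_eq] using ae_tendsto_quadForm
        (fun n => (hX n).precomp (e := fun i : κ n a => ⟨a, i⟩) sigma_mk_injective)
        (sum_normSq_le · a a)
    · simp only [Matrix.diagonal_apply_ne _ hab, sub_zero]
      refine ae_tendsto_sesqForm (fun n => ?_) (sum_normSq_le · a b)
      convert (hX n).precomp (e := Sum.elim (fun i : κ n a => ⟨a, i⟩) fun i : κ n b => ⟨b, i⟩)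
        (sigma_mk_injective.sumElim sigma_mk_injective fun i j h => hab (congrArg Sigma.fst h))
        using 2 with i
      rcases i with i | i <;> rfl
  filter_upwards [ae_all_iff.2 fun a => ae_all_iff.2 (entry a)] with ω hω
  refine tendsto_pi_nhds.2 fun a => tendsto_pi_nhds.2 fun b => (hω a b).congr fun n => ?_
  rw [← Matrix.vecMul_vecMul, ← Matrix.vecMul_vecMul, ← Matrix.dotProduct_mulVec,
    ← Matrix.star_vecMul, Matrix.smul_apply, Matrix.sub_apply, smul_eq_mul, div_eq_inv_mul]
  rfl

end AsympOrthogonal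

section Combiner

variable {κ : Type*} [DecidableEq κ]

/-- The matrix `[X σI]`: applied to the rows of channels and normalized noises it gives the received
signal `X H + σ Z`. -/
noncomputable def noisyPilots (X : Matrix κ κ ℂ) (σ : ℝ) : Matrix κ (κ ⊕ κ) ℂ :=
  Matrix.fromCols X ((σ : ℂ) • 1)

lemma continuous_noisyPilots (X : Matrix κ κ ℂ) : Continuous (noisyPilots X) := by
  refine continuous_matrix fun k a => ?_
  rcases a with a | a <;> simp only [noisyPilots, Matrix.fromCols_apply_inl,
    Matrix.fromCols_apply_inr, Matrix.smul_apply] <;> fun_prop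

variable [Fintype κ]

lemma noisyPilots_mul_of_sumElim {ι : Type*} (X : Matrix κ κ ℂ) (σ : ℝ) (H Z : κ → ι → ℂ) :
    noisyPilots X σ * Matrix.of (Sum.elim H Z) = X * Matrix.of H + (σ : ℂ) • Matrix.of Z := by
  ext k y
  simp [noisyPilots, Matrix.mul_apply, Matrix.one_apply]

lemma continuousAt_matrix_inv {M : Matrix κ κ ℂ} (hM : M.det ≠ 0) :
    ContinuousAt (fun A : Matrix κ κ ℂ => A⁻¹) M := by
  simp only [Matrix.inv_def, Ring.inverse_eq_inv']
  refine ContinuousAt.smul (ContinuousAt.inv₀ ?_ hM) ?_ <;> fun_prop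

lemma star_col_vecMul_inv_vecMul_noisyPilots_zero {X : Matrix κ κ ℂ} (hX : X.det ≠ 0) (j : κ) :
    (star (X.col j) ᵥ* (X * Xᴴ)⁻¹) ᵥ* noisyPilots X 0 = Sum.elim (Pi.single j 1) 0 := by
  have isUnit_det : IsUnit X.det := isUnit_iff_ne_zero.2 hX
  have isUnit_det' : IsUnit Xᴴ.det := by
    simpa only [Matrix.det_conjTranspose, isUnit_star] using isUnit_det
  have star_col : star (X.col j) = Pi.single j 1 ᵥ* Xᴴ := by
    ext k
    simp
  rw [Matrix.mul_inv_rev, star_col, Matrix.vecMul_vecMul _ Xᴴ, ← Matrix.mul_assoc,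
    Matrix.mul_nonsing_inv _ isUnit_det', Matrix.one_mul, noisyPilots, Complex.ofReal_zero,
    zero_smul, Matrix.vecMul_fromCols, Matrix.vecMul_vecMul, Matrix.nonsing_inv_mul _ isUnit_det,
    Matrix.vecMul_one, Matrix.vecMul_zero]

lemma tendsto_combiner {β : Type*} {l : Filter β} {X : Matrix κ κ ℂ} (hX : X.det ≠ 0) (j : κ)
    {Γ : β → Matrix (κ ⊕ κ) (κ ⊕ κ) ℂ} {σ : β → ℝ} (hΓ : Tendsto Γ l (𝓝 1))
    (hσ : Tendsto σ l (𝓝 0)) :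
    Tendsto (fun x => (star (X.col j) ᵥ*
      (noisyPilots X (σ x) * Γ x * (noisyPilots X (σ x))ᴴ)⁻¹) ᵥ* noisyPilots X (σ x)) l
      (𝓝 (Sum.elim (Pi.single j 1) 0)) := by
  have noisyPilots_gram : noisyPilots X 0 * (1 : Matrix (κ ⊕ κ) (κ ⊕ κ) ℂ) * (noisyPilots X 0)ᴴ =
      X * Xᴴ := by
    simp [noisyPilots, Matrix.conjTranspose_fromCols_eq_fromRows_conjTranspose,
      Matrix.fromCols_mul_fromRows]
  have tendsto_noisyPilots : Tendsto (fun x => noisyPilots X (σ x)) l (𝓝 (noisyPilots X 0)) :=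
    ((continuous_noisyPilots X).tendsto 0).comp hσ
  have tendsto_gram : Tendsto (fun x => noisyPilots X (σ x) * Γ x * (noisyPilots X (σ x))ᴴ) l
      (𝓝 (X * Xᴴ)) := by
    have continuous_gram : Continuous fun p : Matrix κ (κ ⊕ κ) ℂ × Matrix (κ ⊕ κ) (κ ⊕ κ) ℂ =>
        p.1 * p.2 * p.1ᴴ := by fun_prop
    simpa only [Function.comp_def, noisyPilots_gram] using
      (continuous_gram.tendsto (noisyPilots X 0, 1)).comp (tendsto_noisyPilots.prodMk_nhds hΓ)
  have det_ne_zero : (X * Xᴴ).det ≠ 0 := by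
    rw [Matrix.det_mul, Matrix.det_conjTranspose]
    exact mul_ne_zero hX (star_ne_zero.2 hX)
  have continuous_vecMul : Continuous fun p : Matrix κ κ ℂ × Matrix κ (κ ⊕ κ) ℂ =>
      (star (X.col j) ᵥ* p.1) ᵥ* p.2 := by fun_prop
  simpa only [Function.comp_def, star_col_vecMul_inv_vecMul_noisyPilots_zero hX j] using
    (continuous_vecMul.tendsto ((X * Xᴴ)⁻¹, noisyPilots X 0)).comp
    (((continuousAt_matrix_inv det_ne_zero).tendsto.comp tendsto_gram).prodMk_nhds
      tendsto_noisyPilots)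

end Combiner

section Estimate

variable {s : ℕ} {V : ∀ n, Matrix (Fin 2 ⊕ Fin 2) (Fin n × Fin s) ℂ}

lemma IsAsympOrthogonal.tendsto_gram (hs : 0 < s)
    (h : IsAsympOrthogonal (fun _ => 1) V fun n _ => n * s) :
    Tendsto (fun n : ℕ => (1 / ((n : ℂ) * s)) • (V n * (V n)ᴴ)) atTop (𝓝 1) := by
  have hs' : (s : ℂ) ≠ 0 := by exact_mod_cast hs.ne'
  have lim := (h.const_smul (s : ℂ)⁻¹).add_const 1
  rw [smul_zero, zero_add] at lim
  refine lim.congr' ?_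
  filter_upwards [eventually_gt_atTop 0] with n hn
  have hn' : (n : ℂ) ≠ 0 := by exact_mod_cast hn.ne'
  rw [Matrix.mul_one, ← Matrix.smul_one_eq_diagonal, smul_smul, smul_sub, smul_smul,
    ← mul_inv_rev, one_div, inv_mul_cancel₀ (mul_ne_zero hn' hs'), one_smul, sub_add_cancel]

lemma estimate_noisyPilots_mul {n : ℕ} {R : Matrix (Fin n) (Fin n) ℂ}
    {RF : Matrix (Fin s) (Fin s) ℂ} (hR : R.trace * RF.trace = n * s) (hn : 0 < n) (hs : 0 < s)
    (x : Fin 2 → ℂ) (X : Matrix (Fin 2) (Fin 2) ℂ) (σ : ℝ)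
    (V : Matrix (Fin 2 ⊕ Fin 2) (Fin n × Fin s) ℂ) :
    estimate R RF x (noisyPilots X σ * V) = ((star x ᵥ* (noisyPilots X σ *
      ((1 / ((n : ℂ) * s)) • (V * Vᴴ)) * (noisyPilots X σ)ᴴ)⁻¹) ᵥ* noisyPilots X σ) ᵥ* V := by
  have hns : (n : ℂ) * s ≠ 0 := by exact_mod_cast (Nat.mul_pos hn hs).ne'
  simp only [estimate, hR, div_self hns, one_smul, sampleCov, Matrix.conjTranspose_mul,
    Matrix.mul_smul, Matrix.smul_mul, Matrix.mul_assoc, Matrix.vecMul_vecMul]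

lemma IsAsympOrthogonal.tendsto_fMeasure_estimate (hs : 0 < s)
    {R A : ∀ n, Matrix (Fin n) (Fin n) ℂ} {RF B : Matrix (Fin s) (Fin s) ℂ}
    (hR : ∀ n, (R n).trace * RF.trace = n * s)
    (hV : IsAsympOrthogonal (fun _ => 1) V fun n _ => n * s) {t : ℕ → Fin 2 ⊕ Fin 2 → ℂ} {K : ℝ}
    (h : IsAsympOrthogonal (fun n => A n ⊗ₖ B) V t) (ht : ∀ n a, ‖t n a‖ ≤ K * n)
    {X : Matrix (Fin 2) (Fin 2) ℂ} (hX : X.det ≠ 0) (j : Fin 2) :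
    Tendsto (fun q : ℕ × ℝ => (fMeasure (A q.1) B (estimate (R q.1) RF (X.col j)
      (noisyPilots X q.2 * V q.1)) - t q.1 (Sum.inl j)) / q.1) (atTop ×ˢ 𝓝 0) (𝓝 0) := by
  refine (h.tendsto_vecMul ht tendsto_fst (tendsto_combiner hX j
    ((hV.tendsto_gram hs).comp tendsto_fst) tendsto_snd)).congr' ?_
  filter_upwards [tendsto_fst.eventually (eventually_gt_atTop 0)] with q hq
  rw [estimate_noisyPilots_mul (hR _) hq hs, fMeasure]
  simp [Pi.single_apply, apply_ite]

end Estimate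

section ChannelTraces

open scoped ComplexOrder

variable {n s L : ℕ} {A : Matrix (Fin n) (Fin n) ℂ}

lemma conjTranspose_hermSqrt (hA : A.IsHermitian) : (hermSqrt hA)ᴴ = hermSqrt hA := by
  rw [hermSqrt, ← hA.cfc_eq]
  exact (cfc_predicate Real.sqrt A).star_eq

lemma hermSqrt_mul_self (hA : A.PosSemidef) :
    hermSqrt hA.isHermitian * hermSqrt hA.isHermitian = A := by
  conv_rhs => rw [← cfc_id_eq hA.isHermitian]
  rw [hermSqrt, cfc_mul_cfc]
  simp only [cfc_eq_mul_diagonal_mul, Real.mul_self_sqrt (hA.eigenvalues_nonneg _), id]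

lemma trace_kronecker_hermSqrt_mul_mul (hA : A.PosSemidef) (F : Matrix (Fin s) (Fin L) ℂ)
    (Q : Matrix (Fin n) (Fin n) ℂ) (B : Matrix (Fin s) (Fin s) ℂ) :
    ((hermSqrt hA.isHermitian ⊗ₖ Fᵀ) * (Q ⊗ₖ B) * (hermSqrt hA.isHermitian ⊗ₖ Fᵀ)ᴴ).trace =
      (A * Q).trace * (Fᵀ * B * (Fᵀ)ᴴ).trace := by
  rw [Matrix.conjTranspose_kronecker, ← Matrix.mul_kronecker_mul, ← Matrix.mul_kronecker_mul,
    Matrix.trace_kronecker, conjTranspose_hermSqrt, Matrix.trace_mul_comm, ← Matrix.mul_assoc,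
    hermSqrt_mul_self hA]

lemma trace_mul_truncInv (hA : A.IsHermitian) {τ : ℝ} (hτ : 0 < τ) :
    (A * truncInv hA τ).trace = effRank hA τ := by
  conv_lhs => enter [1, 1]; rw [← cfc_id_eq hA]
  rw [truncInv, cfc_mul_cfc, trace_cfc, effRank, Finset.card_filter]
  push_cast
  refine Finset.sum_congr rfl fun i _ => ?_
  split_ifs with h
  · exact_mod_cast mul_inv_cancel₀ (hτ.trans_le h).ne'
  · simp

lemma mul_pseudoInv_mul (hA : A.IsHermitian) : A * pseudoInv hA * A = A := by
  have cfc_eq : hA.cfc id * pseudoInv hA * hA.cfc id = hA.cfc id := by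
    simp only [pseudoInv, cfc_mul_cfc, id, mul_inv_mul_cancel]
    rfl
  rwa [cfc_id_eq] at cfc_eq

lemma transpose_mul_pseudoInv_freqCov_mul {F : Matrix (Fin s) (Fin L) ℂ}
    (hF : LinearIndependent ℂ F.col) :
    Fᵀ * pseudoInv (freqCov_isHermitian F) * (Fᵀ)ᴴ = 1 := by
  have isUnit_gram : IsUnit (Fᵀ * (Fᵀ)ᴴ) :=
    (Matrix.PosDef.mul_conjTranspose_self _ (Matrix.vecMul_injective_iff.2 hF)).isUnit
  have sandwich : Fᵀ * (Fᵀ)ᴴ * (Fᵀ * pseudoInv (freqCov_isHermitian F) * (Fᵀ)ᴴ *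
      (Fᵀ * (Fᵀ)ᴴ)) = Fᵀ * (Fᵀ)ᴴ * (1 * (Fᵀ * (Fᵀ)ᴴ)) := by
    have := congrArg (Fᵀ * · * (Fᵀ)ᴴ) (mul_pseudoInv_mul (freqCov_isHermitian F))
    simpa only [freqCov, Matrix.mul_assoc, Matrix.one_mul] using this
  exact isUnit_gram.mul_right_cancel (isUnit_gram.mul_left_cancel sandwich)

open scoped Matrix.Norms.L2Operator

lemma norm_hermSqrt_le (hA : A.PosSemidef) {K : ℝ} (hK : ‖A‖ ≤ K) :
    ‖hermSqrt hA.isHermitian‖ ≤ √K := by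
  refine Real.le_sqrt_of_sq_le (le_of_eq_of_le ?_ hK)
  rw [sq, ← Matrix.l2_opNorm_conjTranspose_mul_self, conjTranspose_hermSqrt, hermSqrt_mul_self hA]

lemma norm_truncInv_le (hA : A.IsHermitian) {τ c : ℝ} (hc : 0 < c) (hτ : c ≤ τ) :
    ‖truncInv hA τ‖ ≤ c⁻¹ := by
  rw [truncInv, ← hA.cfc_eq]
  refine norm_cfc_le (by positivity) fun x _ => ?_
  split_ifs with h
  · rw [norm_inv, Real.norm_of_nonneg (hc.le.trans (hτ.trans h))]
    exact inv_anti₀ hc (hτ.trans h)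
  · simpa using hc.le

end ChannelTraces

section SignalModel

open scoped ComplexOrder Matrix.Norms.L2Operator

variable {Ω : Type*} {κ ν : Type*} {n s L : ℕ} {R : κ → Matrix (Fin n) (Fin n) ℂ}

/-- The linear maps of the signal model: the row `a` of the matrix of channels (indexed by `κ`) and
of noises of level `δ` (indexed by `ν`) is the image of a Gaussian vector under
`rowMap hR F δ a`. -/
noncomputable def rowMap (hR : ∀ k, (R k).IsHermitian) (F : Matrix (Fin s) (Fin L) ℂ) (δ : ℝ) :
    ∀ a : κ ⊕ ν, Matrix (Fin n × Fin (a.elim (fun _ => L) fun _ => s)) (Fin n × Fin s) ℂ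
  | .inl k => hermSqrt (hR k) ⊗ₖ Fᵀ
  | .inr _ => (δ : ℂ) • (1 : Matrix (Fin n × Fin s) (Fin n × Fin s) ℂ)

/-- The Gaussian vectors behind the channels and the noises, as one family indexed by the rows of
the signal model. -/
def rowVector (g : κ → Fin n × Fin L → Ω → ℂ) (z : ν → Fin n × Fin s → Ω → ℂ) :
    ∀ a : κ ⊕ ν, Fin n × Fin (a.elim (fun _ => L) fun _ => s) → Ω → ℂ
  | .inl k => g k
  | .inr b => z b

lemma norm_rowMap_le (hR : ∀ k, (R k).PosSemidef) (F : Matrix (Fin s) (Fin L) ℂ) {K M δ : ℝ}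
    (hK : ∀ k, ‖R k‖ ≤ K) (hδ : |δ| ≤ M) (a : κ ⊕ ν) :
    ‖rowMap (fun k => (hR k).isHermitian) F δ a‖ ≤ √K * ‖Fᵀ‖ + M := by
  rcases a with k | _
  · calc ‖hermSqrt (hR k).isHermitian ⊗ₖ Fᵀ‖ ≤ ‖hermSqrt (hR k).isHermitian‖ * ‖Fᵀ‖ :=
          norm_kronecker_le _ _
      _ ≤ √K * ‖Fᵀ‖ := by
        gcongr
        exact norm_hermSqrt_le (hR k) (hK k)
      _ ≤ √K * ‖Fᵀ‖ + M := le_add_of_nonneg_right ((abs_nonneg δ).trans hδ)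
  · calc ‖(δ : ℂ) • (1 : Matrix (Fin n × Fin s) (Fin n × Fin s) ℂ)‖ ≤ |δ| :=
          opNorm_le_of_sum_normSq_mulVec_le (abs_nonneg δ) fun x => by
            simp [Matrix.smul_mulVec, mul_pow, Finset.mul_sum]
      _ ≤ M := hδ
      _ ≤ √K * ‖Fᵀ‖ + M := le_add_of_nonneg_left (by positivity)

lemma card_row_le (n L s : ℕ) (a : κ ⊕ ν) :
    (Fintype.card (Fin n × Fin (a.elim (fun _ => L) fun _ => s)) : ℝ) ≤ ((L + s : ℕ) : ℝ) * n := by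
  rw [Fintype.card_prod, Fintype.card_fin, Fintype.card_fin, mul_comm]
  rcases a with k | b <;> simp only [Sum.elim_inl, Sum.elim_inr] <;> norm_cast <;> gcongr <;> omega

/-- The rows from which the received signal is combined: the channels with covariances `R k`, then
the noises of level `δ`. -/
noncomputable def signal (hR : ∀ k, (R k).IsHermitian) (F : Matrix (Fin s) (Fin L) ℂ) (δ : ℝ)
    (g : κ → Fin n × Fin L → ℂ) (z : ν → Fin n × Fin s → ℂ) : Matrix (κ ⊕ ν) (Fin n × Fin s) ℂ :=
  Matrix.of (Sum.elim (fun k => fsChannel (hR k) F (g k)) fun b => (δ : ℂ) • z b)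

lemma of_rowVector_vecMul_rowMap (hR : ∀ k, (R k).IsHermitian) (F : Matrix (Fin s) (Fin L) ℂ)
    (δ : ℝ) (g : κ → Fin n × Fin L → Ω → ℂ) (z : ν → Fin n × Fin s → Ω → ℂ) (ω : Ω) :
    (Matrix.of fun a => (rowVector g z a · ω) ᵥ* rowMap hR F δ a) =
      signal hR F δ (fun k y => g k y ω) fun b y => z b y ω := by
  funext a
  rcases a with k | b
  · rfl
  · change (fun y => z b y ω) ᵥ* ((δ : ℂ) • (1 : Matrix (Fin n × Fin s) (Fin n × Fin s) ℂ)) =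
      (δ : ℂ) • fun y => z b y ω
    rw [Matrix.vecMul_smul, Matrix.vecMul_one]

/-- The mean of the form of matrix `A ⊗ B` at each row of `signal`. -/
noncomputable def signalEnergy (R : κ → Matrix (Fin n) (Fin n) ℂ) (F : Matrix (Fin s) (Fin L) ℂ)
    (δ : ℝ) (A : Matrix (Fin n) (Fin n) ℂ) (B : Matrix (Fin s) (Fin s) ℂ) : κ ⊕ ν → ℂ :=
  Sum.elim (fun k => (R k * A).trace * (Fᵀ * B * (Fᵀ)ᴴ).trace)
    fun _ => δ ^ 2 * (A ⊗ₖ B).trace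

lemma trace_rowMap_mul_mul (hR : ∀ k, (R k).PosSemidef) (F : Matrix (Fin s) (Fin L) ℂ) (δ : ℝ)
    (A : Matrix (Fin n) (Fin n) ℂ) (B : Matrix (Fin s) (Fin s) ℂ) (a : κ ⊕ ν) :
    (rowMap (fun k => (hR k).isHermitian) F δ a * (A ⊗ₖ B) *
      (rowMap (fun k => (hR k).isHermitian) F δ a)ᴴ).trace = signalEnergy R F δ A B a := by
  rcases a with k | b
  · exact trace_kronecker_hermSqrt_mul_mul (hR k) F A B
  · change (((δ : ℂ) • (1 : Matrix (Fin n × Fin s) (Fin n × Fin s) ℂ)) * (A ⊗ₖ B) *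
      ((δ : ℂ) • (1 : Matrix (Fin n × Fin s) (Fin n × Fin s) ℂ))ᴴ).trace =
      (δ : ℂ) ^ 2 * (A ⊗ₖ B).trace
    simp only [Matrix.smul_mul, Matrix.one_mul, Matrix.conjTranspose_smul,
      Matrix.conjTranspose_one, Matrix.mul_smul, Matrix.mul_one, Matrix.trace_smul, smul_eq_mul,
      RCLike.star_def, Complex.conj_ofReal]
    ring

lemma signalEnergy_one {F : Matrix (Fin s) (Fin L) ℂ}
    (hRF : ∀ k, (R k).trace * (freqCov F).trace = n * s) :
    signalEnergy (ν := ν) R F 1 1 1 = fun _ => (n : ℂ) * s := by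
  funext a
  rcases a with k | b
  · rw [signalEnergy, Sum.elim_inl, Matrix.mul_one, Matrix.mul_one, Matrix.trace_mul_comm (Fᵀ),
      ← freqCov, hRF]
  · rw [signalEnergy, Sum.elim_inr, Matrix.one_kronecker_one, Matrix.trace_one]
    simp

end SignalModel

section IIDRows

variable {Ω : Type*} [MeasurableSpace Ω] {μ : Measure Ω} {n s L : ℕ}

lemma IsIIDCN.rowVector_two {g : Fin 2 → Fin n × Fin L → Ω → ℂ}
    {Z : Fin 2 × (Fin n × Fin s) → Ω → ℂ} (h : IsIIDCN (Sum.elim (g 0) (Sum.elim (g 1) Z)) μ) :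
    IsIIDCN (fun i : Σ a : Fin 2 ⊕ Fin 2, Fin n × Fin (a.elim (fun _ => L) fun _ => s) =>
      rowVector g (fun k y => Z (k, y)) i.1 i.2) μ := by
  let e : (Σ a : Fin 2 ⊕ Fin 2, Fin n × Fin (a.elim (fun _ => L) fun _ => s)) →
      (Fin n × Fin L) ⊕ (Fin n × Fin L) ⊕ Fin 2 × (Fin n × Fin s)
    | ⟨.inl 0, y⟩ => .inl y
    | ⟨.inl 1, y⟩ => .inr (.inl y)
    | ⟨.inr k, y⟩ => .inr (.inr (k, y))
  have injective_e : Function.Injective e := by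
    rintro ⟨a | a, x⟩ ⟨b | b, y⟩ hab <;> (try fin_cases a) <;> (try fin_cases b) <;>
      rcases hab with ⟨⟩ <;> rfl
  convert h.precomp injective_e using 1
  ext ⟨a | a, y⟩ ω
  · fin_cases a <;> rfl
  · rfl

lemma IsIIDCN.rowVector_one {g : Fin n × Fin L → Ω → ℂ} {w : Fin n × Fin s → Ω → ℂ}
    (h : IsIIDCN (Sum.elim g w) μ) :
    IsIIDCN (fun i : Σ a : Unit ⊕ Unit, Fin n × Fin (a.elim (fun _ => L) fun _ => s) =>
      rowVector (fun _ => g) (fun _ => w) i.1 i.2) μ := by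
  let e : (Σ a : Unit ⊕ Unit, Fin n × Fin (a.elim (fun _ => L) fun _ => s)) →
      (Fin n × Fin L) ⊕ (Fin n × Fin s)
    | ⟨.inl _, y⟩ => .inl y
    | ⟨.inr _, y⟩ => .inr y
  have injective_e : Function.Injective e := by
    rintro ⟨_ | _, x⟩ ⟨_ | _, y⟩ hab <;> rcases hab with ⟨⟩ <;> rfl
  convert h.precomp injective_e using 1
  ext ⟨_ | _, y⟩ ω <;> rfl

end IIDRows

section Situations

open scoped ComplexOrder Matrix.Norms.L2Operator

variable {Ω : Type*} [MeasurableSpace Ω] {μ : Measure Ω} [IsProbabilityMeasure μ] {s L : ℕ}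
  {A : ∀ n, Matrix (Fin n) (Fin n) ℂ} {B : Matrix (Fin s) (Fin s) ℂ}
  {F : Matrix (Fin s) (Fin L) ℂ} {K C M : ℝ} {δ : ℕ → ℝ}

lemma norm_kronecker_le_mul (hA : ∀ n, ‖A n‖ ≤ C) (n : ℕ) : ‖A n ⊗ₖ B‖ ≤ C * ‖B‖ :=
  (norm_kronecker_le _ _).trans (by gcongr; exact hA n)

section Signal

variable {κ ν : Type*} {R : ∀ n, κ → Matrix (Fin n) (Fin n) ℂ}

lemma norm_signalEnergy_le (hR : ∀ n k, (R n k).PosSemidef) (hK : ∀ n k, ‖R n k‖ ≤ K)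
    (hA : ∀ n, ‖A n‖ ≤ C) (hδ : ∀ n, |δ n| ≤ M) (n : ℕ) (a : κ ⊕ ν) :
    ‖signalEnergy (R n) F (δ n) (A n) B a‖ ≤
      ((L + s : ℕ) : ℝ) * ((√K * ‖Fᵀ‖ + M) * (C * ‖B‖) * (√K * ‖Fᵀ‖ + M)) * n := by
  rw [← trace_rowMap_mul_mul (hR n)]
  exact norm_trace_mul_mul_conjTranspose_le (fun n => norm_rowMap_le (hR n) F (hK n) (hδ n))
    (norm_kronecker_le_mul hA) (fun n => card_row_le n L s) n a

lemma ae_isAsympOrthogonal_signal [Countable κ] [Countable ν] [DecidableEq κ] [DecidableEq ν]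
    (hR : ∀ n k, (R n k).PosSemidef) (hK : ∀ n k, ‖R n k‖ ≤ K) (hA : ∀ n, ‖A n‖ ≤ C)
    (hδ : ∀ n, |δ n| ≤ M) {g : ∀ n, κ → Fin n × Fin L → Ω → ℂ}
    {z : ∀ n, ν → Fin n × Fin s → Ω → ℂ}
    (hgz : ∀ n, IsIIDCN (fun i : Σ a : κ ⊕ ν, Fin n × Fin (a.elim (fun _ => L) fun _ => s) =>
      rowVector (g n) (z n) i.1 i.2) μ) :
    ∀ᵐ ω ∂μ, IsAsympOrthogonal (fun n => A n ⊗ₖ B)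
      (fun n => signal (fun k => (hR n k).isHermitian) F (δ n) (fun k y => g n k y ω)
        fun b y => z n b y ω)
      fun n => signalEnergy (R n) F (δ n) (A n) B := by
  filter_upwards [ae_isAsympOrthogonal hgz
    (fun n => norm_rowMap_le (hR n) F (hK n) (hδ n)) (norm_kronecker_le_mul (B := B) hA)
    fun n => card_row_le n L s] with ω h
  simpa only [of_rowVector_vecMul_rowMap, trace_rowMap_mul_mul (hR _)] using h

end Signal

lemma received_eq_noisyPilots_mul {n : ℕ} {R : Fin 2 → Matrix (Fin n) (Fin n) ℂ}
    (hR : ∀ k, (R k).IsHermitian) (F : Matrix (Fin s) (Fin L) ℂ) (X : Matrix (Fin 2) (Fin 2) ℂ)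
    (g : Fin 2 → Fin n × Fin L → ℂ) (σ : ℝ) (Z : Fin 2 × (Fin n × Fin s) → ℂ) :
    received X (fsChannel (hR 0) F (g 0)) (fsChannel (hR 1) F (g 1)) σ Z =
      noisyPilots X σ * signal hR F 1 g fun b y => Z (b, y) := by
  have channels : ![fsChannel (hR 0) F (g 0), fsChannel (hR 1) F (g 1)] =
      fun k => fsChannel (hR k) F (g k) := by
    ext k
    fin_cases k <;> rfl
  simp only [received, signal, noisyPilots_mul_of_sumElim, channels, Complex.ofReal_one, one_smul]

lemma ae_tendsto_fMeasure_estimate (hs : 0 < s) {R : ∀ n, Fin 2 → Matrix (Fin n) (Fin n) ℂ}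
    (hR : ∀ n k, (R n k).PosSemidef) (hK : ∀ n k, ‖R n k‖ ≤ K)
    (hRF : ∀ n k, (R n k).trace * (freqCov F).trace = n * s) (hA : ∀ n, ‖A n‖ ≤ C)
    {X : Matrix (Fin 2) (Fin 2) ℂ} (hX : X.det ≠ 0) {g : ∀ n, Fin 2 → Fin n × Fin L → Ω → ℂ}
    {Z : ∀ n, Fin 2 × (Fin n × Fin s) → Ω → ℂ}
    (hgZ : ∀ n, IsIIDCN (Sum.elim (g n 0) (Sum.elim (g n 1) (Z n))) μ) :
    ∀ᵐ ω ∂μ, ∀ j, Tendsto (fun q : ℕ × ℝ => (fMeasure (A q.1) B (estimate (R q.1 j) (freqCov F)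
      (X.col j) (received X (fsChannel (hR q.1 0).isHermitian F (g q.1 0 · ω))
        (fsChannel (hR q.1 1).isHermitian F (g q.1 1 · ω)) q.2 (Z q.1 · ω))) -
      (R q.1 j * A q.1).trace * (Fᵀ * B * (Fᵀ)ᴴ).trace) / q.1) (atTop ×ˢ 𝓝 0) (𝓝 0) := by
  have isIIDCN (n : ℕ) := (hgZ n).rowVector_two
  have noise_le (_ : ℕ) : |(1 : ℝ)| ≤ 1 := abs_one.le
  have norm_one_le (n : ℕ) : ‖(1 : Matrix (Fin n) (Fin n) ℂ)‖ ≤ 1 :=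
    opNorm_le_of_sum_normSq_mulVec_le zero_le_one fun x => by simp
  filter_upwards [ae_isAsympOrthogonal_signal (B := 1) (F := F) hR hK norm_one_le noise_le isIIDCN,
    ae_isAsympOrthogonal_signal (B := B) (F := F) hR hK hA noise_le isIIDCN] with ω gram form j
  simp only [signalEnergy_one (hRF _), Matrix.one_kronecker_one] at gram
  have lim := IsAsympOrthogonal.tendsto_fMeasure_estimate (R := fun n => R n j) (A := A) (B := B)
    hs (hRF · j) gram form (norm_signalEnergy_le hR hK hA noise_le) hX j
  refine lim.congr fun q => ?_
  rw [received_eq_noisyPilots_mul (fun k => (hR q.1 k).isHermitian) F X fun k y => g q.1 k y ω]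
  rfl

lemma ae_tendsto_fMeasure_sub_smul {R : ∀ n, Matrix (Fin n) (Fin n) ℂ}
    (hR : ∀ n, (R n).PosSemidef) (hK : ∀ n, ‖R n‖ ≤ K) (hA : ∀ n, ‖A n‖ ≤ C)
    (hδ : ∀ n, |δ n| ≤ M) {g : ∀ n, Fin n × Fin L → Ω → ℂ} {w : ∀ n, Fin n × Fin s → Ω → ℂ}
    (hgw : ∀ n, IsIIDCN (Sum.elim (g n) (w n)) μ) :
    ∀ᵐ ω ∂μ, Tendsto (fun n : ℕ => (fMeasure (A n) B (fsChannel (hR n).isHermitian F (g n · ω) -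
      (δ n : ℂ) • (w n · ω)) - ((R n * A n).trace * (Fᵀ * B * (Fᵀ)ᴴ).trace +
        δ n ^ 2 * (A n ⊗ₖ B).trace)) / n) atTop (𝓝 0) := by
  filter_upwards [ae_isAsympOrthogonal_signal (B := B) (F := F) (fun n _ => hR n) (fun n _ => hK n)
    hA hδ fun n => (hgw n).rowVector_one] with ω form
  have lim := form.tendsto_vecMul (norm_signalEnergy_le (fun n _ => hR n) (fun n _ => hK n) hA hδ)
    tendsto_id (tendsto_const_nhds (x := (Sum.elim 1 (-1) : Unit ⊕ Unit → ℂ)))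
  refine lim.congr fun n => ?_
  have row_eq : (Sum.elim 1 (-1) : Unit ⊕ Unit → ℂ) ᵥ* signal (fun _ => (hR n).isHermitian) F
      (δ n) (fun _ y => g n y ω) (fun _ y => w n y ω) =
      fsChannel (hR n).isHermitian F (g n · ω) - (δ n : ℂ) • (w n · ω) := by
    ext y
    simp [Matrix.vecMul, dotProduct, signal, sub_eq_add_neg]
  simp only [id_eq, row_eq, fMeasure]
  simp [signalEnergy]

end Situations

section DFT

variable {N L s : ℕ}

lemma linearIndependent_col_dftRows (hs : L ≤ s) {p : Fin s → Fin N}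
    (hp : Function.Injective p) : LinearIndependent ℂ (dftRows N L p).col := by
  let z (k : Fin s) : ℂ := (Complex.exp (2 * Real.pi * Complex.I / N) ^ (p k : ℕ))⁻¹
  have injective_z : Function.Injective z := fun k k' h => hp <| Fin.ext <|
    (Complex.isPrimitiveRoot_exp N (p k).pos.ne').pow_inj (p k).2 (p k').2 (inv_injective h)
  have dftRows_eq (k : Fin s) (l : Fin L) : dftRows N L p k l = z k ^ (l : ℕ) := by
    simp only [dftRows, Matrix.of_apply, z, ← Complex.exp_nat_mul, ← Complex.exp_neg]
    congr 1
    ring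
  refine Matrix.mulVec_injective_iff.1
    ((injective_iff_map_eq_zero (dftRows N L p).mulVecLin).2 fun v hv => ?_)
  refine Matrix.eq_zero_of_forall_index_sum_mul_pow_eq_zero
    (injective_z.comp (Fin.castLE_injective hs)) fun j => ?_
  refine Eq.trans ?_ (congrFun hv (Fin.castLE hs j))
  simp only [Matrix.mulVecLin_apply, Matrix.mulVec, dotProduct, dftRows_eq, Function.comp_apply,
    mul_comm]

lemma norm_dftRows_apply (p : Fin s → Fin N) (k : Fin s) (l : Fin L) :
    ‖dftRows N L p k l‖ = 1 := by
  rw [dftRows, Matrix.of_apply, Complex.norm_exp]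
  simp [Complex.div_re, Complex.mul_re, Complex.mul_im]

lemma trace_freqCov_dftRows (p : Fin s → Fin N) :
    (freqCov (dftRows N L p)).trace = (s : ℂ) * L := by
  simp [freqCov, Matrix.trace, Matrix.mul_apply, Complex.conj_mul', norm_dftRows_apply]

end DFT

section TrigPoly

variable {n : ℕ}

/-- The trigonometric polynomial `∑ a, w a * e^(-2πiau)`. The quadratic form of the one-ring
covariance is an integral of its squared modulus. -/
noncomputable def trigPoly (w : Fin n → ℂ) (u : ℝ) : ℂ :=
  ∑ a, w a * Complex.exp (-Complex.I * 2 * Real.pi * a * u)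

lemma continuous_trigPoly (w : Fin n → ℂ) : Continuous (trigPoly w) := by
  unfold trigPoly
  fun_prop

lemma normSq_trigPoly (w : Fin n → ℂ) (u : ℝ) : (‖trigPoly w u‖ : ℂ) ^ 2 =
    ∑ a, ∑ b, w a * star (w b) * Complex.exp (-Complex.I * 2 * Real.pi * ((a : ℂ) - b) * u) := by
  rw [← Complex.mul_conj', trigPoly, map_sum, Finset.sum_mul_sum]
  refine Finset.sum_congr rfl fun a _ => Finset.sum_congr rfl fun b _ => ?_
  rw [map_mul, ← Complex.exp_conj, mul_mul_mul_comm, ← Complex.exp_add, RCLike.star_def]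
  congr 2
  simp only [map_mul, map_neg, Complex.conj_I, Complex.conj_ofReal, map_natCast, map_ofNat]
  ring

lemma integral_normSq_trigPoly_comp {φ : ℝ → ℝ} (hφ : Continuous φ) (w : Fin n → ℂ) (x y : ℝ) :
    ((∫ t in x..y, ‖trigPoly w (φ t)‖ ^ 2 : ℝ) : ℂ) = ∑ a, ∑ b, w a * star (w b) *
      ∫ t in x..y, Complex.exp (-Complex.I * 2 * Real.pi * ((a : ℂ) - b) * φ t) := by
  rw [← intervalIntegral.integral_ofReal]
  simp_rw [Complex.ofReal_pow, normSq_trigPoly]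
  rw [intervalIntegral.integral_finsetSum fun a _ => Continuous.intervalIntegrable
    (by fun_prop) _ _]
  refine Finset.sum_congr rfl fun a _ => ?_
  rw [intervalIntegral.integral_finsetSum fun b _ => Continuous.intervalIntegrable
    (by fun_prop) _ _]
  simp_rw [intervalIntegral.integral_const_mul]

lemma integral_exp_sub_mul_eq_zero {a b : ℤ} (hab : a ≠ b) (m : ℕ) : ∫ u in (-m : ℝ)..m,
    Complex.exp (-Complex.I * 2 * Real.pi * ((a : ℂ) - b) * u) = 0 := by
  have sub_ne : (a : ℂ) - b ≠ 0 := sub_ne_zero.2 (by exact_mod_cast hab)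
  have freq_ne : -Complex.I * 2 * Real.pi * ((a : ℂ) - b) ≠ 0 := by
    simp [Real.pi_ne_zero, sub_ne]
  rw [integral_exp_mul_complex freq_ne, div_eq_zero_iff, sub_eq_zero,
    Complex.exp_eq_exp_iff_exists_int]
  refine .inl ⟨-(2 * (a - b) * m), ?_⟩
  push_cast
  ring

lemma integral_normSq_trigPoly (w : Fin n → ℂ) (m : ℕ) :
    ∫ u in (-m : ℝ)..m, ‖trigPoly w u‖ ^ 2 = 2 * m * ∑ a, ‖w a‖ ^ 2 := by
  have diagonal (a : Fin n) : ∑ b, w a * star (w b) * ∫ u in (-m : ℝ)..m,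
      Complex.exp (-Complex.I * 2 * Real.pi * ((a : ℂ) - b) * u) = 2 * m * ‖w a‖ ^ 2 := by
    rw [Finset.sum_eq_single a (fun b _ hb => ?_) (by simp), RCLike.star_def, Complex.mul_conj']
    · simp
      ring
    · have hab : ((a : ℕ) : ℤ) ≠ (b : ℕ) := by exact_mod_cast fun h => hb (Fin.ext h).symm
      have := integral_exp_sub_mul_eq_zero hab m
      push_cast at this
      rw [this, mul_zero]
  have parseval := integral_normSq_trigPoly_comp continuous_id w (-m) m
  simp only [id, diagonal, ← Finset.mul_sum] at parseval
  exact_mod_cast parseval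

end TrigPoly

section RingCov

open scoped ComplexOrder Matrix.Norms.L2Operator

variable {D Δ θ : ℝ}

lemma trace_ringCov (hΔ : Δ ≠ 0) (D θ : ℝ) (L n : ℕ) : (ringCov D Δ L θ n).trace = (n : ℂ) / L := by
  have ringCov_diag (a : Fin n) : ringCov D Δ L θ n a a = 1 / L := by
    have hΔ' : (Δ : ℂ) ≠ 0 := by exact_mod_cast hΔ
    have length : θ + Δ - (θ - Δ) = 2 * Δ := by ring
    simp only [ringCov, Matrix.of_apply, sub_self, mul_zero, zero_mul, Complex.exp_zero,
      intervalIntegral.integral_const, length, Complex.real_smul]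
    push_cast
    field_simp
  simp [Matrix.trace, ringCov_diag, div_eq_mul_inv]

lemma trace_ringCov_mul_trace_freqCov_dftRows (hΔ : Δ ≠ 0) (D θ : ℝ) (N : ℕ) {L s : ℕ}
    (hL : L ≠ 0) (p : Fin s → Fin N) (n : ℕ) :
    (ringCov D Δ L θ n).trace * (freqCov (dftRows N L p)).trace = n * s := by
  have : (L : ℂ) ≠ 0 := Nat.cast_ne_zero.2 hL
  rw [trace_ringCov hΔ, trace_freqCov_dftRows]
  field_simp

lemma star_dotProduct_ringCov_mulVec (D Δ θ : ℝ) (L : ℕ) {n : ℕ} (v : Fin n → ℂ) :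
    star v ⬝ᵥ (ringCov D Δ L θ n *ᵥ v) = ((1 / (2 * Δ * L) *
      ∫ t in (θ - Δ)..(θ + Δ), ‖trigPoly (star v) (D * Real.sin t)‖ ^ 2 : ℝ) : ℂ) := by
  rw [Complex.ofReal_mul, integral_normSq_trigPoly_comp (by fun_prop)]
  simp only [dotProduct, Matrix.mulVec, ringCov, Matrix.of_apply, Finset.mul_sum, Pi.star_apply,
    star_star, Complex.ofReal_mul]
  refine Finset.sum_congr rfl fun a _ => Finset.sum_congr rfl fun b _ => ?_
  push_cast
  simp only [mul_assoc, mul_left_comm, mul_comm]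

lemma posSemidef_ringCov (hΔ : 0 ≤ Δ) (D θ : ℝ) (L n : ℕ) : (ringCov D Δ L θ n).PosSemidef := by
  refine .of_dotProduct_mulVec_nonneg (ringCov_isHermitian D Δ L θ n) fun v => ?_
  rw [star_dotProduct_ringCov_mulVec, Complex.zero_le_real]
  exact mul_nonneg (by positivity) (intervalIntegral.integral_nonneg (by linarith) fun t _ =>
    sq_nonneg _)

lemma norm_le_of_forall_star_dotProduct_mulVec_le {ι : Type*} [Fintype ι] [DecidableEq ι]
    {A : Matrix ι ι ℂ} (hA : A.PosSemidef) {K : ℝ} (hK : 0 ≤ K)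
    (h : ∀ v : ι → ℂ, star v ⬝ᵥ (A *ᵥ v) ≤ ((K * ∑ i, ‖v i‖ ^ 2 : ℝ) : ℂ)) : ‖A‖ ≤ K := by
  rw [← cfc_id ℝ A hA.isHermitian.isSelfAdjoint]
  refine norm_cfc_le hK fun x hx => ?_
  rw [hA.isHermitian.spectrum_real_eq_range_eigenvalues] at hx
  obtain ⟨i, rfl⟩ := hx
  have norm_eigenvector := EuclideanSpace.norm_sq_eq (hA.isHermitian.eigenvectorBasis i)
  rw [hA.isHermitian.eigenvectorBasis.orthonormal.1 i, one_pow] at norm_eigenvector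
  have rayleigh := (Complex.le_def.1 (h (hA.isHermitian.eigenvectorBasis i))).1
  rw [← norm_eigenvector, mul_one, Complex.ofReal_re] at rayleigh
  rw [id, Real.norm_of_nonneg (hA.eigenvalues_nonneg i), hA.isHermitian.eigenvalues_eq]
  exact rayleigh

/-- The substitution `u = D sin t` has the density `1 / (D cos t) ≤ 1 / (D κ)`. -/
lemma integral_normSq_trigPoly_sin_le (hD : 0 < D) (hΔ : 0 ≤ Δ) {κ : ℝ} (hκ : 0 < κ)
    (hcos : ∀ t ∈ Set.Icc (θ - Δ) (θ + Δ), κ ≤ Real.cos t) {n : ℕ} (w : Fin n → ℂ) :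
    ∫ t in (θ - Δ)..(θ + Δ), ‖trigPoly w (D * Real.sin t)‖ ^ 2 ≤
      (D * κ)⁻¹ * (2 * ⌈D⌉₊) * ∑ a, ‖w a‖ ^ 2 := by
  have continuous_w := continuous_trigPoly w
  have hle : θ - Δ ≤ θ + Δ := by linarith
  have sin_le : Real.sin (θ - Δ) ≤ Real.sin (θ + Δ) :=
    monotoneOn_of_deriv_nonneg (convex_Icc _ _) Real.continuousOn_sin
      Real.differentiable_sin.differentiableOn (fun t ht => by
        rw [Real.deriv_sin]
        exact hκ.le.trans (hcos t (interior_subset ht)))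
      (Set.left_mem_Icc.2 hle) (Set.right_mem_Icc.2 hle) hle
  calc ∫ t in (θ - Δ)..(θ + Δ), ‖trigPoly w (D * Real.sin t)‖ ^ 2
      ≤ ∫ t in (θ - Δ)..(θ + Δ), (D * κ)⁻¹ *
        (((fun u => ‖trigPoly w u‖ ^ 2) ∘ fun t => D * Real.sin t) t * (D * Real.cos t)) := by
        refine intervalIntegral.integral_mono_on hle (Continuous.intervalIntegrable
          (by fun_prop) _ _) (Continuous.intervalIntegrable (by fun_prop) _ _) fun t ht => ?_
        rw [Function.comp_apply, ← div_eq_inv_mul, le_div_iff₀ (by positivity)]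
        gcongr
        exact hcos t ht
    _ = (D * κ)⁻¹ * ∫ u in (D * Real.sin (θ - Δ))..(D * Real.sin (θ + Δ)),
        ‖trigPoly w u‖ ^ 2 := by
      rw [intervalIntegral.integral_const_mul, intervalIntegral.integral_comp_mul_deriv
        (fun t _ => (Real.hasDerivAt_sin t).const_mul D) (by fun_prop) (by fun_prop)]
    _ ≤ (D * κ)⁻¹ * ∫ u in (-⌈D⌉₊ : ℝ)..⌈D⌉₊, ‖trigPoly w u‖ ^ 2 := by
      have hceil : D ≤ ⌈D⌉₊ := Nat.le_ceil D
      gcongr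
      refine intervalIntegral.integral_mono_interval ?_ (by gcongr) ?_
        (ae_of_all _ fun u => sq_nonneg _) (Continuous.intervalIntegrable (by fun_prop) _ _)
      · nlinarith [Real.neg_one_le_sin (θ - Δ)]
      · nlinarith [Real.sin_le_one (θ + Δ)]
    _ = (D * κ)⁻¹ * (2 * ⌈D⌉₊) * ∑ a, ‖w a‖ ^ 2 := by
      rw [integral_normSq_trigPoly]
      ring

lemma norm_ringCov_le (hD : 0 < D) (hΔ : 0 ≤ Δ) {κ : ℝ} (hκ : 0 < κ)
    (hcos : ∀ t ∈ Set.Icc (θ - Δ) (θ + Δ), κ ≤ Real.cos t) (L n : ℕ) :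
    ‖ringCov D Δ L θ n‖ ≤ 1 / (2 * Δ * L) * ((D * κ)⁻¹ * (2 * ⌈D⌉₊)) := by
  refine norm_le_of_forall_star_dotProduct_mulVec_le (posSemidef_ringCov hΔ D θ L n)
    (by positivity) fun v => ?_
  rw [star_dotProduct_ringCov_mulVec, Complex.real_le_real, mul_assoc (1 / _)]
  gcongr
  simpa only [Pi.star_apply, norm_star] using integral_normSq_trigPoly_sin_le hD hΔ hκ hcos (star v)

lemma half_le_cos {x y t : ℝ} (hx : -(Real.pi / 3) ≤ x) (hy : y ≤ Real.pi / 3)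
    (ht : t ∈ Set.Icc x y) : 1 / 2 ≤ Real.cos t := by
  rw [← Real.cos_pi_div_three, ← Real.cos_abs t]
  exact Real.cos_le_cos_of_nonneg_of_le_pi (abs_nonneg t) (by linarith [Real.pi_pos])
    (abs_le.2 ⟨hx.trans ht.1, ht.2.trans hy⟩)

end RingCov

lemma tendsto_deltaF_sub_deltaFLimit_div {β : Type*} {l : Filter β} {N : β → ℕ} {s L : ℕ}
    {F : Matrix (Fin s) (Fin L) ℂ} (hF : LinearIndependent ℂ F.col)
    {R₁ R₂ : ∀ n, Matrix (Fin n) (Fin n) ℂ} (hR₁ : ∀ n, (R₁ n).IsHermitian) {τ : ℕ → ℝ}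
    (hτ : ∀ n, 0 < τ n) {x y : ∀ b, Fin (N b) × Fin s → ℂ} {e : β → ℂ}
    (hx : Tendsto (fun b => (fMeasure (truncInv (hR₁ (N b)) (τ (N b)))
      (pseudoInv (freqCov_isHermitian F)) (x b) - ((R₁ (N b) *
        truncInv (hR₁ (N b)) (τ (N b))).trace *
          (Fᵀ * pseudoInv (freqCov_isHermitian F) * (Fᵀ)ᴴ).trace + e b)) / N b) l (𝓝 0))
    (hy : Tendsto (fun b => (fMeasure (truncInv (hR₁ (N b)) (τ (N b)))
      (pseudoInv (freqCov_isHermitian F)) (y b) - ((R₂ (N b) *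
        truncInv (hR₁ (N b)) (τ (N b))).trace *
          (Fᵀ * pseudoInv (freqCov_isHermitian F) * (Fᵀ)ᴴ).trace + e b)) / N b) l (𝓝 0)) :
    Tendsto (fun b => (deltaF (hR₁ (N b)) (τ (N b)) F (x b) (y b) -
      deltaFLimit L (hR₁ (N b)) (τ (N b)) (R₂ (N b))) / ((N b : ℂ) * s)) l (𝓝 0) := by
  have lim := (hx.sub hy).div_const (s : ℂ)
  rw [sub_zero, zero_div] at lim
  refine lim.congr fun b => ?_
  simp only [deltaF, deltaFLimit, trace_mul_truncInv _ (hτ _),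
    transpose_mul_pseudoInv_freqCov_mul hF, Matrix.trace_one, Fintype.card_fin]
  rw [← sub_div, div_div]
  congr 1
  ring

open scoped ComplexOrder Matrix.Norms.L2Operator in
theorem theorem3_general {Ω : Type*} [MeasurableSpace Ω] (μ : Measure Ω) [IsProbabilityMeasure μ]
    {s L : ℕ} (hs : 0 < s) {F : Matrix (Fin s) (Fin L) ℂ} (hF : LinearIndependent ℂ F.col)
    {R₁ R₂ : ∀ n, Matrix (Fin n) (Fin n) ℂ} (hR₁ : ∀ n, (R₁ n).PosSemidef)
    (hR₂ : ∀ n, (R₂ n).PosSemidef) {K : ℝ} (hK₁ : ∀ n, ‖R₁ n‖ ≤ K) (hK₂ : ∀ n, ‖R₂ n‖ ≤ K)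
    (hRF₁ : ∀ n, (R₁ n).trace * (freqCov F).trace = n * s)
    (hRF₂ : ∀ n, (R₂ n).trace * (freqCov F).trace = n * s)
    {τ : ℕ → ℝ} {c : ℝ} (hc : 0 < c) (hτ : ∀ n, c ≤ τ n)
    (gB gA : ∀ n : ℕ, Fin n × Fin L → Ω → ℂ) :
    (∀ (X : Matrix (Fin 2) (Fin 2) ℂ) (Z : ∀ n : ℕ, Fin 2 × (Fin n × Fin s) → Ω → ℂ),
      X.det ≠ 0 → (∀ n, IsIIDCN (Sum.elim (gB n) (Sum.elim (gA n) (Z n))) μ) →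
      ∀ᵐ ω ∂μ, Tendsto
        (fun q : ℕ × ℝ =>
          let Y := received X (fsChannel (hR₁ q.1).isHermitian F (gB q.1 · ω))
            (fsChannel (hR₂ q.1).isHermitian F (gA q.1 · ω)) q.2 (Z q.1 · ω)
          (deltaF (hR₁ q.1).isHermitian (τ q.1) F (estimate (R₁ q.1) (freqCov F) (X.col 0) Y)
              (estimate (R₂ q.1) (freqCov F) (X.col 1) Y) -
            deltaFLimit L (hR₁ q.1).isHermitian (τ q.1) (R₂ q.1)) / ((q.1 : ℂ) * s))
        (atTop ×ˢ 𝓝 0) (𝓝 0)) ∧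
    (∀ (ε : ℕ → ℝ) (M : ℝ) (wB wA : ∀ n : ℕ, Fin n × Fin s → Ω → ℂ),
      (∀ n, |ε n| ≤ M) →
      (∀ n, IsIIDCN (Sum.elim (gB n) (wB n)) μ) →
      (∀ n, IsIIDCN (Sum.elim (gA n) (wA n)) μ) →
      ∀ᵐ ω ∂μ, Tendsto
        (fun n : ℕ =>
          (deltaF (hR₁ n).isHermitian (τ n) F
              (fsChannel (hR₁ n).isHermitian F (gB n · ω) - (ε n : ℂ) • (wB n · ω))
              (fsChannel (hR₂ n).isHermitian F (gA n · ω) - (ε n : ℂ) • (wA n · ω)) -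
            deltaFLimit L (hR₁ n).isHermitian (τ n) (R₂ n)) / ((n : ℂ) * s))
        atTop (𝓝 0)) := by
  have τ_pos (n : ℕ) : 0 < τ n := hc.trans_le (hτ n)
  have norm_truncInv (n : ℕ) := norm_truncInv_le (hR₁ n).isHermitian hc (hτ n)
  refine ⟨fun X Z hX hgZ => ?_, fun ε M wB wA hε hgB hgA => ?_⟩
  · filter_upwards [ae_tendsto_fMeasure_estimate (R := fun n => ![R₁ n, R₂ n])
      (B := pseudoInv (freqCov_isHermitian F)) (g := fun n => ![gB n, gA n]) hs
      (fun n => Fin.forall_fin_two.2 ⟨hR₁ n, hR₂ n⟩) (fun n => Fin.forall_fin_two.2 ⟨hK₁ n, hK₂ n⟩)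
      (fun n => Fin.forall_fin_two.2 ⟨hRF₁ n, hRF₂ n⟩) norm_truncInv hX hgZ] with ω h
    refine tendsto_deltaF_sub_deltaFLimit_div hF (fun n => (hR₁ n).isHermitian) τ_pos
      (e := fun _ => 0) ?_ ?_
    · simp only [add_zero]
      exact h 0
    · simp only [add_zero]
      exact h 1
  · filter_upwards [ae_tendsto_fMeasure_sub_smul (F := F) hR₁ hK₁ norm_truncInv hε hgB,
      ae_tendsto_fMeasure_sub_smul (F := F) hR₂ hK₂ norm_truncInv hε hgA] with ω hB hA
    exact tendsto_deltaF_sub_deltaFLimit_div hF (fun n => (hR₁ n).isHermitian) τ_pos hB hA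

end PilotID

open PilotID in
theorem theorem3 {Ω : Type*} [MeasurableSpace Ω] (μ : Measure Ω) [IsProbabilityMeasure μ]
    -- array and scattering geometry
    (D Δ θ₁ θ₂ : ℝ) (hD : 0 < D) (hΔ : 0 < Δ)
    (hθ₁ : -(Real.pi / 3) ≤ θ₁ - Δ ∧ θ₁ + Δ ≤ Real.pi / 3)
    (hθ₂ : -(Real.pi / 3) ≤ θ₂ - Δ ∧ θ₂ + Δ ≤ Real.pi / 3)
    -- paths, and overlapping subcarriers out of `N`
    (N L s : ℕ) (hL : 0 < L) (hs : L ≤ s) (p : Fin s → Fin N) (hp : Function.Injective p)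
    -- eigenvalue thresholds
    (τ : ℕ → ℝ) (c : ℝ) (hc : 0 < c) (hτ : ∀ n, c ≤ τ n)
    -- channel coefficients of Bob and Ava with `n` antennas
    (gB gA : ∀ n : ℕ, Fin n × Fin L → Ω → ℂ) :
    -- the estimates obtained from the received signal, for many antennas and high SNR
    (∀ (ρB ρA : ℝ) (φ ψ : Fin 2 → ℝ) (Z : ∀ n : ℕ, Fin 2 × (Fin n × Fin s) → Ω → ℂ),
      0 < ρB → 0 < ρA → (pilots ρB ρA φ ψ).det ≠ 0 →
      (∀ n, IsIIDCN (Sum.elim (gB n) (Sum.elim (gA n) (Z n))) μ) →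
      ∀ᵐ ω ∂μ, Tendsto
        (fun q : ℕ × ℝ =>
          let R1 := ringCov D Δ L θ₁ q.1
          let R2 := ringCov D Δ L θ₂ q.1
          let hR1 : R1.IsHermitian := ringCov_isHermitian D Δ L θ₁ q.1
          let hR2 : R2.IsHermitian := ringCov_isHermitian D Δ L θ₂ q.1
          let F := dftRows N L p
          let X := pilots ρB ρA φ ψ
          let hB := fsChannel hR1 F (fun i => gB q.1 i ω)
          let hA := fsChannel hR2 F (fun i => gA q.1 i ω)
          let Y := received X hB hA q.2 (fun i => Z q.1 i ω)
          let hatB := estimate R1 (freqCov F) (fun k => X k 0) Y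
          let hatA := estimate R2 (freqCov F) (fun k => X k 1) Y
          (deltaF hR1 (τ q.1) F hatB hatA - deltaFLimit L hR1 (τ q.1) R2)
            / ((q.1 : ℂ) * (s : ℂ)))
        (atTop ×ˢ 𝓝[≥] 0) (𝓝 0)) ∧
    -- estimates with Gaussian errors of equal, possibly non-vanishing, mean square
    (∀ (ε : ℕ → ℝ) (M : ℝ) (wB wA : ∀ n : ℕ, Fin n × Fin s → Ω → ℂ),
      (∀ n, |ε n| ≤ M) →
      (∀ n, IsIIDCN (Sum.elim (gB n) (wB n)) μ) →
      (∀ n, IsIIDCN (Sum.elim (gA n) (wA n)) μ) →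
      ∀ᵐ ω ∂μ, Tendsto
        (fun n : ℕ =>
          let R1 := ringCov D Δ L θ₁ n
          let R2 := ringCov D Δ L θ₂ n
          let hR1 : R1.IsHermitian := ringCov_isHermitian D Δ L θ₁ n
          let hR2 : R2.IsHermitian := ringCov_isHermitian D Δ L θ₂ n
          let F := dftRows N L p
          let hatB := fsChannel hR1 F (fun i => gB n i ω) - (ε n : ℂ) • (fun i => wB n i ω)
          let hatA := fsChannel hR2 F (fun i => gA n i ω) - (ε n : ℂ) • (fun i => wA n i ω)
          (deltaF hR1 (τ n) F hatB hatA - deltaFLimit L hR1 (τ n) R2)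
            / ((n : ℂ) * (s : ℂ)))
        atTop (𝓝 0)) := by
  have norm_le {θ : ℝ} (hθ : -(Real.pi / 3) ≤ θ - Δ ∧ θ + Δ ≤ Real.pi / 3) :=
    norm_ringCov_le hD hΔ.le one_half_pos (fun _ => half_le_cos hθ.1 hθ.2) L
  refine (theorem3_general μ (hL.trans_le hs) (linearIndependent_col_dftRows hs hp)
    (posSemidef_ringCov hΔ.le D θ₁ L) (posSemidef_ringCov hΔ.le D θ₂ L) (norm_le hθ₁) (norm_le hθ₂)
    (trace_ringCov_mul_trace_freqCov_dftRows hΔ.ne' D θ₁ N hL.ne' p)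
    (trace_ringCov_mul_trace_freqCov_dftRows hΔ.ne' D θ₂ N hL.ne' p) hc hτ gB gA).imp_left ?_
  exact fun received ρB ρA φ ψ Z _ _ hX hgZ => (received _ Z hX hgZ).mono fun _ h =>
    h.mono_left (Filter.prod_mono le_rfl nhdsWithin_le_nhds)
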